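/- Let $A=\{0\}$, $B=\{1\}$, $C=\{2\}$, $X=\{1,2\}$, $Y=\{0,2\}$, $Z=\{0,1\}$ be the nonempty proper subsets of $\mathbb{Z}_3$. For $m\ge 1$ let $H(m,3)$ be the graph on $\mathbb{Z}_3^m$ in which two points are adjacent iff they differ in exactly one coordinate. The induced degree of a set $U\subseteq\mathbb{Z}_3^m$ is the maximum degree of the subgraph of $H(m,3)$ induced by $U$, and $U$ is called canonical if $|U|\ge 3^{m-1}+1$, $U$ is disjoint from some maximum size independent set of $H(m,3)$, and $U$ has induced degree at most $1$. To a function $f:\mathbb{Z}_3^d\to\{A,B,C,X,Y,Z\}$ corresponds the set $\bigcup_{x\in\mathbb{Z}_3^d} f(x)\times\{x\}\subseteq\mathbb{Z}_3^{d+1}$; the induced degree of $f$ is that of this set, and $f$ is canonical if this set is canonical. Theorem. Let $n\ge 6$ and let $U_f:\mathbb{Z}_3^n\to\{A,B,C,X,Y,Z\}$ have induced degree $1$ and satisfy $U_f(0^n)=X$. Then there exists $I\subseteq[n]$ with $|I|\ge n-4$ such that the restriction of $U_f$ to $H=\{x\in\mathbb{Z}_3^n : x_i=0 \text{ for all } i\notin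 I\}$ is canonical, where $H$ is identified with $\mathbb{Z}_3^{I}\cong\mathbb{Z}_3^{|I|}$. -/

import Mathlib

/-- The Hamming graph on `ℤ₃^κ`: two points are adjacent iff their Hamming distance is one.
For `κ = Fin n` this is `H(n, 3)`. -/
def hammingGraph (κ : Type*) [Fintype κ] : SimpleGraph (κ → ZMod 3) where
  Adj x y := hammingDist x y = 1
  symm := ⟨fun x y h => by rw [hammingDist_comm]; exact h⟩
  loopless := ⟨fun x h => by simp at h⟩

instance hammingGraph.instDecidableRelAdj (κ : Type*) [Fintype κ] :
    DecidableRel (hammingGraph κ).Adj :=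
  fun x y => inferInstanceAs (Decidable (hammingDist x y = 1))

/-- The induced degree of `U ⊆ ℤ₃^κ`: the maximum degree of the subgraph of the Hamming graph
induced by `U` (it is `0` if `U` is empty). -/
def inducedDegree {κ : Type*} [Fintype κ] (U : Finset (κ → ZMod 3)) : ℕ :=
  ((hammingGraph κ).induce {x | x ∈ U}).maxDegree

/-- `U ⊆ ℤ₃^κ` (with `κ` nonempty) is a canonical set if it has at least `3 ^ (|κ| - 1) + 1`
points, is disjoint from a maximum size independent set of the Hamming graph, and has induced
degree at most `1`. -/
def IsCanonicalSet {κ : Type*} [Fintype κ] [Nonempty κ] (U : Finset (κ → ZMod 3)) : Prop :=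
  3 ^ (Fintype.card κ - 1) + 1 ≤ U.card ∧
  (∃ S : Finset (κ → ZMod 3), (hammingGraph κ).IsMaximumIndepSet S ∧ Disjoint U S) ∧
  inducedDegree U ≤ 1

/-- The six symbols `A, B, C, X, Y, Z`, naming the nonempty proper subsets of `ℤ₃`. -/
inductive Block : Type
  | A | B | C | X | Y | Z
  deriving DecidableEq

/-- The subset of `ℤ₃` named by a symbol. -/
def Block.toFinset : Block → Finset (ZMod 3)
  | A => {0}
  | B => {1}
  | C => {2}
  | X => {1, 2}
  | Y => {0, 2}
  | Z => {0, 1}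

/-- The subset `⋃ x, f x × {x}` of `ℤ₃ × ℤ₃^ι` corresponding to `f : ℤ₃^ι → {A, B, C, X, Y, Z}`.
The coordinate set of `ℤ₃ × ℤ₃^ι` is `Option ι`: the coordinate `none` is the additional (first)
one, and `some i` is the coordinate `i` of `ℤ₃^ι`. -/
def correspondingSet {ι : Type*} [Fintype ι] [DecidableEq ι] (f : (ι → ZMod 3) → Block) :
    Finset (Option ι → ZMod 3) :=
  Finset.univ.filter fun p => p none ∈ (f fun i => p (some i)).toFinset

/-- The induced degree of a function is that of the corresponding set. -/
def functionInducedDegree {ι : Type*} [Fintype ι] [DecidableEq ι]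
    (f : (ι → ZMod 3) → Block) : ℕ :=
  inducedDegree (correspondingSet f)

/-- A function is canonical if the corresponding set is canonical. -/
def IsCanonicalFunction {ι : Type*} [Fintype ι] [DecidableEq ι]
    (f : (ι → ZMod 3) → Block) : Prop :=
  IsCanonicalSet (correspondingSet f)

/-- The restriction of `f` to the coordinate subspace `{x | ∀ i ∉ I, x i = 0}`, which is
identified with `ℤ₃^I`. -/
def restrictToCoords {ι : Type*} [DecidableEq ι] (f : (ι → ZMod 3) → Block) (I : Finset ι) :
    (I → ZMod 3) → Block :=
  fun y => f fun i => if h : i ∈ I then y ⟨i, h⟩ else 0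

/-! Look at the values of `f` at `a e_i + b e_j` with `a`, `b` nonzero. Since `f 0 = X`, low degree
leaves three types for each pair of coordinates (`trichotomy`): the value contains `s a b` (the pair
is checkered), or `s a` (`i` dominates `j`), or `s b` (`j` dominates `i`), for a sign `s`.

The checkered pairs form a graph without alternating four-cycles (`not_alternating`), that is, a
threshold graph. Such a graph on `n` vertices has a clique and an independent set with together at
least `n + 1` elements (`exists_clique_indep`). Cliques have at most five elements (`not_six`), so
there is an independent set `I` with at least `n - 4` elements.

On `I`, domination is a tournament without three-cycles (`not_cycle`), so each nonempty subset of
`I` has a sink, dominated by all its other elements (`exists_sink`). The sign with which `i`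
dominates depends on `i` only (`dom_sign_eq`); call it `ε i`. By induction on the support, the value
of `f` at a nonzero `y` supported in `I` is the single element `∑ ε i * y i`, summed over the
support without its sink `l` (`mem_iff_sum`). It differs from the full sum by `ε l * y l ≠ 0`, and
at the origin `X` omits `0`. Thus the restriction avoids the graph of a linear form with nonzero
coefficients, which is a maximum independent set. Every fibre is nonempty and the fibre over the
origin has two points, which gives the required size.

The facts about two, three, four and six coordinates are finite. They are checked by an exhaustive
search on bitmasks that the kernel evaluates (`refute`), whose soundness is `not_refute`. -/

/-! ### The search on bitmasks -/

namespace BitSearch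

/-- `force x k` is `k x`, written so that kernel reduction evaluates `x` first. -/
def force {α : Type} (x : ℕ) (k : ℕ → α) : α :=
  Nat.rec (k 0) (fun n _ => k (Nat.succ n)) x

theorem force_eq {α : Type} (x : ℕ) (k : ℕ → α) : force x k = k x := by
  cases x <;> rfl

/-- The union, over the `n` lowest ternary digits of `v`, of the lines through `v`. -/
def lines (v n : ℕ) : ℕ :=
  Nat.rec 0 (fun i s => Nat.lor s
    (Nat.shiftLeft (Nat.add (Nat.add 1 (Nat.pow 2 (Nat.pow 3 i)))
        (Nat.pow 2 (Nat.mul 2 (Nat.pow 3 i))))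
      (Nat.add (Nat.mul (Nat.div v (Nat.pow 3 (Nat.succ i))) (Nat.pow 3 (Nat.succ i)))
        (Nat.mod v (Nat.pow 3 i))))) n

/-- The set `s` without the element `v`. -/
def eraseBit (s v : ℕ) : ℕ :=
  Nat.xor (Nat.lor s (Nat.shiftLeft 1 v)) (Nat.shiftLeft 1 v)

/-- Membership test. -/
def hasBit (s v : ℕ) : Bool :=
  Nat.beq (Nat.land 1 (Nat.shiftRight s v)) 1

/-- The position of the highest bit of a number less than `2 ^ 2 ^ n`. -/
def topBit (n : ℕ) (w : ℕ) : ℕ :=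
  Nat.rec (motive := fun _ => ℕ → ℕ → ℕ) (fun _ acc => acc) (fun j ih w acc =>
    bif Nat.beq (Nat.shiftRight w (Nat.pow 2 j)) 0 then ih w acc
    else ih (Nat.shiftRight w (Nat.pow 2 j)) (Nat.add acc (Nat.pow 2 j))) n w 0

/-- Bitmask of the neighbours of `v` in the Hamming graph with `n` coordinates. -/
def nbrs (n v : ℕ) : ℕ := eraseBit (lines v n) v

/-- Set difference. -/
def diff (s t : ℕ) : ℕ := Nat.xor (Nat.lor s t) t

/-- Three subsets of `{0, …, w - 1}` as a positive number. The lowest 64 bits, computed from `r`,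
serve to give different states different hash values. -/
def pack (w r T F O : ℕ) : ℕ :=
  Nat.lor (Nat.lor 1 (Nat.mod r (Nat.pow 2 64)))
    (Nat.lor (Nat.shiftLeft (Nat.mod T (Nat.pow 2 w)) 64)
      (Nat.lor (Nat.shiftLeft (Nat.mod F (Nat.pow 2 w)) (Nat.add 64 w))
        (Nat.shiftLeft (Nat.mod O (Nat.pow 2 w)) (Nat.add 64 (Nat.mul 2 w)))))

/-- Apply a function to the three sets encoded by `pack`. -/
def unpack {α : Type} (w s : ℕ) (k : ℕ → ℕ → ℕ → α) : α :=
  k (Nat.mod (Nat.shiftRight s 64) (Nat.pow 2 w))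
    (Nat.mod (Nat.shiftRight s (Nat.add 64 w)) (Nat.pow 2 w))
    (Nat.mod (Nat.shiftRight s (Nat.add 64 (Nat.mul 2 w))) (Nat.pow 2 w))

/-- Add the point `v` to the set `T` of points known to be present. The points of `F` are known to
be absent, and those of `O` have a neighbour in `T`. The result is `0` in case of a conflict. -/
def add (d w v r T F O : ℕ) : ℕ :=
  bif Nat.ble w v then pack w r T F O else
  bif hasBit T v then pack w r T F O else
  bif hasBit F v then 0 else
  (fun N =>
    -- The dimension is at most six in all uses, and `3 * 3 ^ 6 = 2187 < 2 ^ 12`. Soundness does not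
    -- rest on this, because membership of `u` in `K` is tested again.
    (fun K => force (topBit 12 K) fun u =>
      (fun T₁ F₁ => bif Nat.beq (Nat.land T₁ F₁) 0 then pack w r T₁ F₁ (Nat.lor O N) else 0)
        (Nat.lor T (Nat.shiftLeft 1 v))
        (Nat.lor (Nat.lor F (Nat.land O N)) (bif hasBit K u then
          Nat.lor (eraseBit N u) (eraseBit (nbrs (Nat.succ d) u) v) else 0)))
      (Nat.land T N))
    (nbrs (Nat.succ d) v)

/-- Add a point to a state. -/
def addState (d w v s : ℕ) : ℕ :=
  bif Nat.beq s 0 then 0 else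
  unpack w s (add d w v (Nat.add (Nat.mul s 6364136223846793005) (Nat.mul v 1442695040888963407)))

/-- The candidate for a forced point, used by `propagate`. -/
def candidate (q T F : ℕ) : ℕ :=
  (fun a b c => topBit 12 (diff (Nat.lor
      (Nat.lor (Nat.land b c) (Nat.shiftLeft (Nat.land a c) q))
      (Nat.shiftLeft (Nat.land a b) (Nat.mul 2 q))) T))
    (Nat.mod F (Nat.pow 2 q))
    (Nat.mod (Nat.shiftRight F q) (Nat.pow 2 q))
    (Nat.shiftRight F (Nat.mul 2 q))

/-- Whether the two other points with the same first `d` coordinates as `v` are absent. -/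
def isForced (q F v : ℕ) : Bool :=
  bif hasBit F (Nat.mod (Nat.add v q) (Nat.mul 3 q)) then
    hasBit F (Nat.mod (Nat.add v (Nat.mul 2 q)) (Nat.mul 3 q)) else false

/-- Add a point that is forced because the two others with the same first `d` coordinates are
absent, and continue with `ih`. -/
def propagateStep (d q w : ℕ) (ih : ℕ → ℕ) (s : ℕ) : ℕ :=
  force s fun s => unpack w s fun T F _ => force (candidate q T F) fun v =>
    bif isForced q F v then bif hasBit T v then s else ih (addState d w v s) else s

/-- Add forced points repeatedly. -/
def propagate (d q w fuel s : ℕ) : ℕ :=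
  Nat.rec (motive := fun _ => ℕ → ℕ) (fun s => s) (fun _ ih => propagateStep d q w ih) fuel s

/-- Add all points of a list. -/
def addList (d w : ℕ) (l : List ℕ) (s : ℕ) : ℕ :=
  List.rec (motive := fun _ => ℕ → ℕ) (fun s => s)
    (fun v _ ih s => force s fun s => force v fun v => ih (addState d w v s)) l s

/-- The cell to branch on: an undecided cell in `sel`, if possible one with an absent point, or `q`
if there is none. -/
def branchCell (q sel T F : ℕ) : ℕ :=
  (fun u => (fun g => bif Nat.beq u 0 then q else topBit 12 (bif Nat.beq g 0 then u else g))
      (Nat.land u (Nat.lor F (Nat.lor (Nat.shiftRight F q) (Nat.shiftRight F (Nat.mul 2 q))))))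
    (diff sel (Nat.lor T (Nat.lor (Nat.shiftRight T q) (Nat.shiftRight T (Nat.mul 2 q)))))

/-- Branch on a cell, and continue with `ih`. -/
def branchStep (d q w sel : ℕ) (ih : ℕ → Bool) (s : ℕ) : Bool :=
  force s fun s => bif Nat.beq s 0 then true else
  force (unpack w s fun T F _ => branchCell q sel T F) fun x =>
  bif Nat.beq x q then false else
  bif ih (propagate d q w q (addList d w [x] s)) then
    bif ih (propagate d q w q (addList d w [Nat.add q x] s)) then
      ih (propagate d q w q (addList d w [Nat.add (Nat.mul 2 q) x] s))
    else false
  else false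

/-- Repeated branching. -/
def branch (d q w sel fuel s : ℕ) : Bool :=
  Nat.rec (motive := fun _ => ℕ → Bool) (fun s => Nat.beq s 0)
    (fun _ ih => branchStep d q w sel ih) fuel s

/-- Case distinction over a list of alternatives. -/
def alternatives (d q w : ℕ) (ih : ℕ → Bool) (L : List (List ℕ)) (s : ℕ) : Bool :=
  List.rec (motive := fun _ => Bool) true (fun alt _ r =>
    bif ih (propagate d q w q (addList d w alt s)) then r else false) L

/-- Case distinction over lists of alternatives, followed by branching. -/
def levels (d q w sel : ℕ) (ls : List (List (List ℕ))) (s : ℕ) : Bool :=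
  List.rec (motive := fun _ => ℕ → Bool) (branch d q w sel q) (fun L _ ih s =>
    force s fun s => bif Nat.beq s 0 then true else alternatives d q w ih L s) ls s

/-- Bitmask of the points of weight at most `m` in dimension `d`. -/
def ball : ℕ → ℕ → ℕ
  | 0, _ => 1
  | d + 1, 0 => ball d 0
  | d + 1, m + 1 => Nat.lor (ball d (m + 1)) (Nat.lor (Nat.shiftLeft (ball d m) (Nat.pow 3 d))
      (Nat.shiftLeft (ball d m) (Nat.mul 2 (Nat.pow 3 d))))

/-- `refute d m ls` is `true` only if no set of induced degree at most one that meets every line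
in the last direction satisfies one alternative from each list in `ls`. Branching is restricted to
cells of weight at most `m`. -/
def refute (d m : ℕ) (ls : List (List (List ℕ))) : Bool :=
  -- The initial state `1` unpacks to three empty sets; `0` would mean a conflict.
  force (Nat.pow 3 d) fun q => force (ball d m) fun sel => levels d q (Nat.mul 3 q) sel ls 1

end BitSearch

/-! ### Soundness of the search -/

namespace BitSearch

theorem hasBit_eq (s v : ℕ) : hasBit s v = s.testBit v := by
  have h : Nat.land 1 (Nat.shiftRight s v) = 1 &&& (s >>> v) := rfl
  rw [hasBit, h, Nat.testBit, Nat.one_and_eq_mod_two]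
  rcases Nat.mod_two_eq_zero_or_one (s >>> v) with h | h <;> rw [h] <;> rfl

theorem testBit_lor (a b v : ℕ) : (Nat.lor a b).testBit v = (a.testBit v || b.testBit v) :=
  Nat.testBit_or a b v

theorem testBit_land (a b v : ℕ) : (Nat.land a b).testBit v = (a.testBit v && b.testBit v) :=
  Nat.testBit_and a b v

theorem testBit_shiftLeft (a i v : ℕ) :
    (Nat.shiftLeft a i).testBit v = (decide (i ≤ v) && a.testBit (v - i)) :=
  Nat.testBit_shiftLeft a

theorem testBit_shiftRight (a i v : ℕ) : (Nat.shiftRight a i).testBit v = a.testBit (i + v) :=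
  Nat.testBit_shiftRight a

theorem testBit_mod_pow (a i v : ℕ) :
    (Nat.mod a (Nat.pow 2 i)).testBit v = (decide (v < i) && a.testBit v) :=
  Nat.testBit_mod_two_pow a i v

theorem testBit_eraseBit {s v u : ℕ} (h : (eraseBit s v).testBit u) : s.testBit u ∧ u ≠ v := by
  have h1 : eraseBit s v = (s ||| (1 <<< v)) ^^^ (1 <<< v) := rfl
  rw [h1, Nat.testBit_xor, Nat.testBit_or, Nat.one_shiftLeft, Nat.testBit_two_pow] at h
  by_cases hu : v = u
  · simp [hu] at h
  · exact ⟨by simpa [hu] using h, fun h => hu h.symm⟩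

/-- Soundness data for `refute`: the set `M` of present points and a relation `R` containing
adjacency such that each point of `M` has at most one neighbour in `M`. -/
structure Sound (d q w : ℕ) (M : ℕ → Prop) (R : ℕ → ℕ → Prop) : Prop where
  nbrs : ∀ v u, v < w → (nbrs (d + 1) v).testBit u → u < w ∧ R v u
  symm : ∀ v u, R v u → R u v
  unique : ∀ c a b, a < w → b < w → M c → M a → M b → R c a → R c b → a = b
  cell : ∀ x, M x ∨ M (q + x) ∨ M (2 * q + x)
  forced : ∀ v, M v ∨ M ((v + q) % (3 * q)) ∨ M ((v + 2 * q) % (3 * q))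

/-- The three sets of a state are correct for `M`. -/
def Inv (w : ℕ) (M : ℕ → Prop) (R : ℕ → ℕ → Prop) (T F O : ℕ) : Prop :=
  (∀ v, T.testBit v → v < w ∧ M v) ∧ (∀ v, F.testBit v → ¬ M v) ∧
    ∀ v, O.testBit v → ∃ u, T.testBit u ∧ R v u

/-- A state that is not a conflict and whose three sets are correct for `M`. -/
def Valid (w : ℕ) (M : ℕ → Prop) (R : ℕ → ℕ → Prop) (s : ℕ) : Prop :=
  s ≠ 0 ∧ unpack w s (Inv w M R)

variable {d q w : ℕ} {M : ℕ → Prop} {R : ℕ → ℕ → Prop}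

theorem testBit_salt (r v : ℕ) : (Nat.lor 1 (Nat.mod r (Nat.pow 2 64))).testBit (64 + v) = false := by
  rw [testBit_lor, testBit_mod_pow, Nat.testBit_lt_two_pow (Nat.one_lt_two_pow (by omega))]
  simp

/-- The three sets occupy disjoint ranges of `w` bits above the 64 salt bits, and the lowest bit,
always set, distinguishes the state from a conflict. -/
theorem valid_pack {r T F O : ℕ} (h : Inv w M R T F O) : Valid w M R (pack w r T F O) := by
  have hT : ∀ v, (Nat.mod (Nat.shiftRight (pack w r T F O) 64) (Nat.pow 2 w)).testBit v =
      (decide (v < w) && T.testBit v) := by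
    intro v
    rw [testBit_mod_pow, testBit_shiftRight, pack, testBit_lor, testBit_salt]
    simp only [testBit_lor, testBit_shiftLeft, testBit_mod_pow, Nat.add_eq, Nat.mul_eq]
    by_cases hv : v < w
    · have h1 : ¬ 64 + w ≤ 64 + v := by omega
      have h2 : ¬ 64 + 2 * w ≤ 64 + v := by omega
      simp [hv, h1, h2]
    · simp [hv]
  have hF : ∀ v, (Nat.mod (Nat.shiftRight (pack w r T F O) (Nat.add 64 w)) (Nat.pow 2 w)).testBit v =
      (decide (v < w) && F.testBit v) := by
    intro v
    rw [testBit_mod_pow, testBit_shiftRight, pack, testBit_lor, Nat.add_eq, Nat.add_assoc,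
      testBit_salt]
    simp only [testBit_lor, testBit_shiftLeft, testBit_mod_pow, Nat.add_eq, Nat.mul_eq]
    by_cases hv : v < w
    · have h1 : 64 + (w + v) - (64 + w) = v := by omega
      have h2 : ¬ 64 + 2 * w ≤ 64 + (w + v) := by omega
      have h3 : ¬ 64 + (w + v) - 64 < w := by omega
      have h4 : 64 + w ≤ 64 + (w + v) := by omega
      simp only [hv, h1, h2, h3, h4]; simp
    · simp [hv]
  have hO : ∀ v, (Nat.mod (Nat.shiftRight (pack w r T F O) (Nat.add 64 (Nat.mul 2 w)))
      (Nat.pow 2 w)).testBit v = (decide (v < w) && O.testBit v) := by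
    intro v
    rw [testBit_mod_pow, testBit_shiftRight, pack, testBit_lor, Nat.add_eq, Nat.add_assoc,
      testBit_salt]
    simp only [testBit_lor, testBit_shiftLeft, testBit_mod_pow, Nat.add_eq, Nat.mul_eq]
    by_cases hv : v < w
    · have h1 : 64 + (2 * w + v) - (64 + 2 * w) = v := by omega
      have h2 : 64 + 2 * w ≤ 64 + (2 * w + v) := by omega
      have h3 : ¬ 64 + (2 * w + v) - 64 < w := by omega
      have h4 : ¬ 64 + (2 * w + v) - (64 + w) < w := by omega
      simp only [hv, h1, h2, h3, h4]; simp
    · simp [hv]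
  refine ⟨fun h0 => ?_, fun v hv => ?_, fun v hv => ?_, fun v hv => ?_⟩
  · have h1 : (pack w r T F O).testBit 0 = true := by
      rw [pack, testBit_lor, testBit_lor]; simp
    rw [h0] at h1
    simp at h1
  · rw [hT] at hv
    exact h.1 v (by simp_all)
  · rw [hF] at hv
    exact h.2.1 v (by simp_all)
  · rw [hO] at hv
    obtain ⟨u, hu, hR⟩ := h.2.2 v (by simp_all)
    exact ⟨u, by rw [hT]; simp [hu, (h.1 u hu).1], hR⟩

theorem valid_add (hS : Sound d q w M R) {v r T F O : ℕ} (h : Inv w M R T F O) (hv : M v) :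
    Valid w M R (add d w v r T F O) := by
  unfold add
  cases hw : Nat.ble w v
  swap
  · exact valid_pack h
  cases hTv : hasBit T v
  swap
  · exact valid_pack h
  cases hFv : hasBit F v
  swap
  · exact absurd hv (h.2.1 v (by rw [← hasBit_eq, hFv]))
  have hvw : v < w := by
    by_contra hc
    rw [Nat.ble_eq_true_of_le (not_lt.mp hc)] at hw
    cases hw
  rw [hasBit_eq] at hTv
  simp only [cond_false, force_eq]
  set N := nbrs (Nat.succ d) v with hN
  have hNR : ∀ u, N.testBit u → u < w ∧ R v u := fun u hu => hS.nbrs v u hvw hu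
  set K := Nat.land T N with hK
  set u := topBit 12 K
  set T₁ := Nat.lor T (Nat.shiftLeft 1 v) with hT₁
  set F₁ := Nat.lor (Nat.lor F (Nat.land O N)) (bif hasBit K u then
          Nat.lor (eraseBit N u) (eraseBit (nbrs (Nat.succ d) u) v) else 0) with hF₁
  have hone : ∀ x, (Nat.shiftLeft 1 v).testBit x = decide (v = x) := fun x => by
    have : Nat.shiftLeft 1 v = 2 ^ v := Nat.one_shiftLeft v
    rw [this, Nat.testBit_two_pow]
  have hT' : ∀ x, T₁.testBit x → x < w ∧ M x := by
    intro x hx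
    rw [hT₁, testBit_lor, hone, Bool.or_eq_true, decide_eq_true_eq] at hx
    rcases hx with hx | rfl
    · exact h.1 x hx
    · exact ⟨hvw, hv⟩
  have hF' : ∀ x, F₁.testBit x → ¬ M x := by
    intro x hx hM
    rw [hF₁, testBit_lor, testBit_lor, testBit_land] at hx
    simp only [Bool.or_eq_true, Bool.and_eq_true] at hx
    rcases hx with (hx | ⟨hx, hx'⟩) | hx
    · exact h.2.1 x hx hM
    -- A point adjacent both to an old point `y` of `T` and to the new point `v` would have two
    -- neighbours if it were present.
    · obtain ⟨y, hy, hR⟩ := h.2.2 x hx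
      have := hS.unique x y v (h.1 y hy).1 hvw hM (h.1 y hy).2 hv hR (hS.symm _ _ (hNR x hx').2)
      rw [this, hTv] at hy
      cases hy
    -- If `v` has a present neighbour `u`, then `u` and `v` are each other's only neighbours, so all
    -- other neighbours of either are absent.
    · cases hKu : hasBit K u
      · simp [hKu] at hx
      · rw [hKu, cond_true, testBit_lor, Bool.or_eq_true] at hx
        rw [hasBit_eq, hK, testBit_land, Bool.and_eq_true] at hKu
        have hMu := h.1 u hKu.1
        have hRu := hNR u hKu.2
        rcases hx with hx | hx
        · obtain ⟨h1, h2⟩ := testBit_eraseBit hx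
          exact h2 (hS.unique v x u (hNR x h1).1 hMu.1 hv hM hMu.2 (hNR x h1).2 hRu.2)
        · obtain ⟨h1, h2⟩ := testBit_eraseBit hx
          exact h2 (hS.unique u x v (hS.nbrs u x hMu.1 h1).1 hvw hMu.2 hM hv (hS.nbrs u x hMu.1 h1).2
            (hS.symm _ _ hRu.2))
  cases hc : Nat.beq (Nat.land T₁ F₁) 0
  · exfalso
    have hne : Nat.land T₁ F₁ ≠ 0 := fun h0 => by rw [h0] at hc; cases hc
    obtain ⟨x, hx⟩ := Nat.exists_testBit_of_ne_zero hne
    rw [testBit_land, Bool.and_eq_true] at hx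
    exact hF' x hx.2 (hT' x hx.1).2
  · refine valid_pack ⟨hT', hF', fun x hx => ?_⟩
    rw [testBit_lor, Bool.or_eq_true] at hx
    rcases hx with hx | hx
    · obtain ⟨y, hy, hR⟩ := h.2.2 x hx
      exact ⟨y, by rw [hT₁, testBit_lor, hy]; rfl, hR⟩
    · exact ⟨v, by rw [hT₁, testBit_lor, hone]; simp, hS.symm _ _ (hNR x hx).2⟩

theorem valid_addState (hS : Sound d q w M R) {v s : ℕ} (h : Valid w M R s) (hv : M v) :
    Valid w M R (addState d w v s) := by
  unfold addState
  cases hs : Nat.beq s 0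
  · exact valid_add hS h.2 hv
  · exact absurd (Nat.eq_of_beq_eq_true hs) h.1

theorem valid_addList (hS : Sound d q w M R) (l : List ℕ) {s : ℕ} (h : Valid w M R s)
    (hl : ∀ v ∈ l, M v) : Valid w M R (addList d w l s) := by
  induction l generalizing s with
  | nil => exact h
  | cons v l ih =>
    have : addList d w (v :: l) s = addList d w l (addState d w v s) := by
      simp only [addList, force_eq]
    rw [this]
    exact ih (valid_addState hS h (hl v (by simp))) fun u hu => hl u (by simp [hu])

/-- The choice made by `candidate` is not trusted: a point is added only after `isForced` confirms
that the other two points of its cell are absent. Likewise `fuel` affects only the strength of the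
search. -/
theorem valid_propagate (hS : Sound d q w M R) (fuel : ℕ) {s : ℕ} (h : Valid w M R s) :
    Valid w M R (propagate d q w fuel s) := by
  induction fuel generalizing s with
  | zero => exact h
  | succ n ih =>
    have hstep : propagate d q w (n + 1) s = propagateStep d q w (propagate d q w n) s := rfl
    rw [hstep]
    simp only [propagateStep, force_eq, unpack]
    generalize candidate q _ _ = v
    generalize hF : Nat.mod (Nat.shiftRight s (Nat.add 64 w)) (Nat.pow 2 w) = F
    generalize hasBit _ v = b
    have hF' : ∀ v, F.testBit v → ¬ M v := by
      rw [← hF]; exact h.2.2.1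
    cases hc : isForced q F v
    · exact h
    cases b
    swap
    · exact h
    refine ih (valid_addState hS h ?_)
    unfold isForced at hc
    cases h1 : hasBit F (Nat.mod (Nat.add v q) (Nat.mul 3 q))
    · rw [h1] at hc; cases hc
    · rw [h1, cond_true, hasBit_eq] at hc
      rw [hasBit_eq] at h1
      rcases hS.forced v with h | h | h
      · exact h
      · exact absurd h (hF' _ h1)
      · exact absurd h (hF' _ hc)

/-- Whatever cell is selected, one of its three points lies in `M`, and the corresponding branch
stays valid. -/
theorem not_branch (hS : Sound d q w M R) (sel fuel : ℕ) {s : ℕ} (h : Valid w M R s) :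
    branch d q w sel fuel s = false := by
  induction fuel generalizing s with
  | zero =>
    cases hs : Nat.beq s 0
    · exact hs
    · exact absurd (Nat.eq_of_beq_eq_true hs) h.1
  | succ n ih =>
    have hstep : branch d q w sel (n + 1) s = branchStep d q w sel (branch d q w sel n) s := rfl
    rw [hstep]
    simp only [branchStep, force_eq]
    cases hs : Nat.beq s 0
    swap
    · exact absurd (Nat.eq_of_beq_eq_true hs) h.1
    generalize unpack w s _ = x
    cases Nat.beq x q
    swap
    · rfl
    have key : ∀ y, M y → branch d q w sel n (propagate d q w q (addList d w [y] s)) = false :=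
      fun y hy => ih (valid_propagate hS q (valid_addList hS [y] h (by simpa using hy)))
    simp only [cond_false]
    rcases hS.cell x with hx | hx | hx
    · rw [key x hx]; rfl
    · rw [show Nat.add q x = q + x from rfl, key (q + x) hx]
      simp
    · rw [show Nat.add (Nat.mul 2 q) x = 2 * q + x from rfl, key (2 * q + x) hx]
      simp

theorem alternatives_eq (f : ℕ → Bool) (L : List (List ℕ)) (s : ℕ) :
    alternatives d q w f L s = L.all fun alt => f (propagate d q w q (addList d w alt s)) := by
  induction L with
  | nil => rfl
  | cons a L ih =>
    rw [List.all_cons, ← ih]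
    change (bif f (propagate d q w q (addList d w a s)) then alternatives d q w f L s else false) = _
    cases f (propagate d q w q (addList d w a s)) <;> rfl

theorem not_levels (hS : Sound d q w M R) (sel : ℕ) (ls : List (List (List ℕ))) {s : ℕ}
    (h : Valid w M R s) (hl : ∀ L ∈ ls, ∃ alt ∈ L, ∀ v ∈ alt, M v) :
    levels d q w sel ls s = false := by
  induction ls generalizing s with
  | nil => exact not_branch hS sel q h
  | cons L ls ih =>
    obtain ⟨alt, ha, hM⟩ := hl L (by simp)
    have hstep : levels d q w sel (L :: ls) s = force s fun s => bif Nat.beq s 0 then true else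
        alternatives d q w (levels d q w sel ls) L s := rfl
    rw [hstep, force_eq, alternatives_eq]
    cases hs : Nat.beq s 0
    swap
    · exact absurd (Nat.eq_of_beq_eq_true hs) h.1
    rw [cond_false, List.all_eq_false]
    refine ⟨alt, ha, ?_⟩
    rw [ih (valid_propagate hS q (valid_addList hS alt h hM)) fun L hL => hl L (by simp [hL])]
    simp

theorem not_refute {m : ℕ} (hS : Sound d (3 ^ d) (3 * 3 ^ d) M R) (ls : List (List (List ℕ)))
    (hl : ∀ L ∈ ls, ∃ alt ∈ L, ∀ v ∈ alt, M v) : refute d m ls = false := by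
  unfold refute
  simp only [force_eq]
  refine not_levels hS _ ls ⟨one_ne_zero, ?_⟩ hl
  have h0 : ∀ i v, (Nat.mod (Nat.shiftRight 1 (64 + i)) (Nat.pow 2 (3 * 3 ^ d))).testBit v = false := by
    intro i v
    rw [testBit_mod_pow, testBit_shiftRight, Nat.testBit_lt_two_pow (Nat.one_lt_two_pow (by omega)),
      Bool.and_false]
  exact ⟨fun v hv => absurd hv (Bool.eq_false_iff.mp (h0 0 v)),
    fun v hv => absurd hv (Bool.eq_false_iff.mp (h0 (3 * 3 ^ d) v)),
    fun v hv => absurd hv (Bool.eq_false_iff.mp (h0 (2 * (3 * 3 ^ d)) v))⟩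

end BitSearch

/-! ### Low degree and its transport along maps -/

/-- Two points differ in exactly one coordinate. -/
def LineAdj {κ : Type*} (p q : κ → ZMod 3) : Prop := p ≠ q ∧ ∃ i, ∀ j, j ≠ i → p j = q j

theorem hammingDist_eq_one_iff {κ : Type*} [Fintype κ] (p q : κ → ZMod 3) :
    hammingDist p q = 1 ↔ LineAdj p q := by
  unfold hammingDist
  rw [Finset.card_eq_one]
  constructor
  · rintro ⟨i, hi⟩
    have h : ∀ j, p j ≠ q j ↔ j = i := fun j => by
      simpa using Finset.ext_iff.mp hi j
    exact ⟨fun hpq => (h i).mpr rfl (congrFun hpq i), i, fun j hj => by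
      by_contra hc; exact hj ((h j).mp hc)⟩
  · rintro ⟨hne, i, hi⟩
    refine ⟨i, Finset.ext fun j => ?_⟩
    simp only [Finset.mem_filter, Finset.mem_univ, true_and, Finset.mem_singleton]
    refine ⟨fun hj => by by_contra hc; exact hj (hi j hc), ?_⟩
    rintro rfl hj
    exact hne (funext fun k => (em (k = j)).elim (fun hk => hk ▸ hj) (hi k))

theorem LineAdj.symm {κ : Type*} {p q : κ → ZMod 3} (h : LineAdj p q) : LineAdj q p :=
  ⟨h.1.symm, h.2.imp fun _ hi j hj => (hi j hj).symm⟩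

/-- Each point of the set has at most one neighbour in the set. -/
def LowDegree {κ : Type*} (U : Set (κ → ZMod 3)) : Prop :=
  ∀ c ∈ U, ∀ a ∈ U, ∀ b ∈ U, LineAdj c a → LineAdj c b → a = b

theorem inducedDegree_le_one_iff {κ : Type*} [Fintype κ] (U : Finset (κ → ZMod 3)) :
    inducedDegree U ≤ 1 ↔ LowDegree (U : Set (κ → ZMod 3)) := by
  unfold inducedDegree
  constructor
  · intro h c hc a ha b hb hca hcb
    have h1 := (SimpleGraph.degree_le_maxDegree _ (⟨c, hc⟩ : {x | x ∈ U})).trans h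
    rw [← SimpleGraph.card_neighborFinset_eq_degree, Finset.card_le_one] at h1
    have h2 := h1 ⟨a, ha⟩
      ((SimpleGraph.mem_neighborFinset _ _ _).mpr ((hammingDist_eq_one_iff c a).mpr hca)) ⟨b, hb⟩
      ((SimpleGraph.mem_neighborFinset _ _ _).mpr ((hammingDist_eq_one_iff c b).mpr hcb))
    simpa using h2
  · intro h
    refine SimpleGraph.maxDegree_le_of_forall_degree_le _ _ fun c => ?_
    rw [← SimpleGraph.card_neighborFinset_eq_degree, Finset.card_le_one]
    intro a ha b hb
    exact Subtype.ext (h c c.2 a a.2 b b.2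
      ((hammingDist_eq_one_iff _ _).mp ((SimpleGraph.mem_neighborFinset _ _ _).mp ha))
      ((hammingDist_eq_one_iff _ _).mp ((SimpleGraph.mem_neighborFinset _ _ _).mp hb)))

theorem LowDegree.preimage {κ κ' : Type*} {U : Set (κ → ZMod 3)} (h : LowDegree U)
    {φ : (κ' → ZMod 3) → κ → ZMod 3} (hφ : ∀ p q, LineAdj p q → LineAdj (φ p) (φ q))
    (hi : Function.Injective φ) : LowDegree (φ ⁻¹' U) :=
  fun _ hc _ ha _ hb hca hcb => hi (h _ hc _ ha _ hb (hφ _ _ hca) (hφ _ _ hcb))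

/-- The points of `ℤ₃ × ℤ₃^ι` described by a function to symbols. -/
def blockSet {ι : Type*} (f : (ι → ZMod 3) → Block) : Set (Option ι → ZMod 3) :=
  {p | p none ∈ (f fun i => p (some i)).toFinset}

theorem coe_correspondingSet {ι : Type*} [Fintype ι] [DecidableEq ι] (f : (ι → ZMod 3) → Block) :
    (correspondingSet f : Set (Option ι → ZMod 3)) = blockSet f := by
  ext p; simp [correspondingSet, blockSet]

/-- The set corresponding to the function has induced degree at most one. -/
def Good {ι : Type*} (f : (ι → ZMod 3) → Block) : Prop := LowDegree (blockSet f)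

theorem functionInducedDegree_le_one_iff {ι : Type*} [Fintype ι] [DecidableEq ι]
    (f : (ι → ZMod 3) → Block) : functionInducedDegree f ≤ 1 ↔ Good f := by
  rw [functionInducedDegree, inducedDegree_le_one_iff, coe_correspondingSet, Good]

/-- Extend `φ` by the identity on the additional coordinate; the extension is injective and
preserves adjacency. -/
theorem Good.comp {ι κ : Type*} {f : (ι → ZMod 3) → Block} (h : Good f)
    {φ : (κ → ZMod 3) → ι → ZMod 3} (hi : Function.Injective φ)
    (hφ : ∀ p q, LineAdj p q → LineAdj (φ p) (φ q)) : Good (f ∘ φ) := by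
  have := LowDegree.preimage h
    (φ := fun (p : Option κ → ZMod 3) o => o.elim (p none) (φ fun i => p (some i))) ?_ ?_
  · exact this
  · rintro p q ⟨hne, i, hi'⟩
    rcases i with _ | i
    · have he : (fun i => p (some i)) = fun i => q (some i) := funext fun j => hi' _ (by simp)
      refine ⟨fun h0 => hne (funext fun o => ?_), none, fun o ho => ?_⟩
      · rcases o with _ | j
        · exact congrFun h0 none
        · exact congrFun he j
      · rcases o with _ | j
        · exact absurd rfl ho
        · simp only [Option.elim, he]
    · have h1 : LineAdj (fun i => p (some i)) fun i => q (some i) :=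
        ⟨fun h0 => hne (funext fun o => by
          rcases o with _ | j
          · exact hi' _ (by simp)
          · exact congrFun h0 j), i, fun j hj => hi' _ (by simpa using hj)⟩
      obtain ⟨hne', k, hk⟩ := hφ _ _ h1
      refine ⟨fun h0 => hne' (funext fun j => congrFun h0 (some j)), some k, fun o ho => ?_⟩
      rcases o with _ | j
      · exact hi' _ (by simp)
      · exact hk j (by simpa using ho)
  · intro p q hpq
    have h0 := hi (funext fun j => congrFun hpq (some j) : φ (fun i => p (some i)) =
      φ fun i => q (some i))
    refine funext fun o => ?_
    rcases o with _ | j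
    · exact congrFun hpq none
    · exact congrFun h0 j

/-- The extension of a point by zero along an injection of coordinates. -/
noncomputable def extendZero {ι κ : Type*} (e : κ → ι) (y : κ → ZMod 3) : ι → ZMod 3 :=
  Function.extend e y 0

theorem extendZero_apply {ι κ : Type*} {e : κ → ι} (he : Function.Injective e) (y : κ → ZMod 3)
    (a : κ) : extendZero e y (e a) = y a :=
  he.extend_apply _ _ _

theorem extendZero_of_notMem {ι κ : Type*} {e : κ → ι} (y : κ → ZMod 3) {i : ι}
    (hi : ¬ ∃ a, e a = i) : extendZero e y i = 0 :=
  Function.extend_apply' _ _ _ hi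

theorem extendZero_injective {ι κ : Type*} {e : κ → ι} (he : Function.Injective e) :
    Function.Injective (extendZero e) := fun x y h => funext fun a => by
  rw [← extendZero_apply he x, h, extendZero_apply he]

theorem extendZero_zero {ι κ : Type*} (e : κ → ι) : extendZero e 0 = 0 :=
  Function.extend_zero e

theorem Good.extendZero {ι κ : Type*} {f : (ι → ZMod 3) → Block} (h : Good f) {e : κ → ι}
    (he : Function.Injective e) : Good (f ∘ extendZero e) := by
  refine h.comp (extendZero_injective he) fun p q hpq => ?_
  obtain ⟨hne, i, hi⟩ := hpq
  refine ⟨fun h0 => hne (extendZero_injective he h0), e i, fun j hj => ?_⟩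
  by_cases hx : ∃ a, e a = j
  · obtain ⟨a, rfl⟩ := hx
    rw [extendZero_apply he, extendZero_apply he]
    exact hi a fun h0 => hj (by rw [h0])
  · rw [extendZero_of_notMem _ hx, extendZero_of_notMem _ hx]

theorem Good.smul {ι : Type*} {f : (ι → ZMod 3) → Block} (h : Good f) {σ : ι → ZMod 3}
    (hσ : ∀ i, σ i ≠ 0) : Good fun x => f (σ * x) := by
  have hi : Function.Injective fun x : ι → ZMod 3 => σ * x := fun x y hxy =>
    funext fun i => mul_left_cancel₀ (hσ i) (congrFun hxy i)
  refine h.comp hi fun p q ⟨hne, i, hpq⟩ => ⟨fun h0 => hne (hi h0), i, fun j hj => ?_⟩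
  simp only [Pi.mul_apply, hpq j hj]

/-! ### Ternary digits as points of the Hamming graph -/

/-- The point of `ℤ₃ × ℤ₃^d` with the ternary digits of `v`, the highest one giving the additional
coordinate. -/
def digitPoint (d v : ℕ) : Option (Fin d) → ZMod 3
  | none => ((v / 3 ^ d : ℕ) : ZMod 3)
  | some i => ((v / 3 ^ (i : ℕ) : ℕ) : ZMod 3)

namespace BitSearch

/-- The shift is by `v` with its digit `i` cleared, and the shifted mask has bits `0`, `3 ^ i`, `2 *
3 ^ i`, one for each value of that digit. -/
theorem exists_of_testBit_lines {v n u : ℕ} (h : (lines v n).testBit u) :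
    ∃ i < n, ∃ t < 3, u = v / 3 ^ (i + 1) * 3 ^ (i + 1) + v % 3 ^ i + t * 3 ^ i := by
  induction n with
  | zero => simp [lines] at h
  | succ n ih =>
    have hstep : lines v (n + 1) = lines v n ||| ((1 + 2 ^ 3 ^ n + 2 ^ (2 * 3 ^ n)) <<<
      (v / 3 ^ (n + 1) * 3 ^ (n + 1) + v % 3 ^ n)) := rfl
    rw [hstep, Nat.testBit_or, Bool.or_eq_true] at h
    rcases h with h | h
    · obtain ⟨i, hi, t, ht⟩ := ih h
      exact ⟨i, by omega, t, ht⟩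
    · refine ⟨n, by omega, ?_⟩
      set b := v / 3 ^ (n + 1) * 3 ^ (n + 1) + v % 3 ^ n
      rw [Nat.testBit_shiftLeft, Bool.and_eq_true, decide_eq_true_eq] at h
      obtain ⟨hb, h⟩ := h
      have h3 : 1 ≤ 3 ^ n := Nat.one_le_pow _ _ (by norm_num)
      -- Distinct powers of two have disjoint bits, so their sum is their bitwise disjunction.
      have hor : 1 + 2 ^ 3 ^ n + 2 ^ (2 * 3 ^ n) =
          2 ^ (2 * 3 ^ n) ||| (2 ^ (3 ^ n) ||| 2 ^ 0) := by
        have e1 : 2 ^ (3 ^ n) ||| 2 ^ 0 = 2 ^ (3 ^ n) + 2 ^ 0 := by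
          have := Nat.two_pow_add_eq_or_of_lt (i := 3 ^ n) (b := 2 ^ 0)
            (Nat.pow_lt_pow_right (by norm_num) (by omega)) 1
          simpa using this.symm
        have e2 : 2 ^ (2 * 3 ^ n) ||| (2 ^ (3 ^ n) + 2 ^ 0) =
            2 ^ (2 * 3 ^ n) + (2 ^ (3 ^ n) + 2 ^ 0) := by
          have hlt : 2 ^ (3 ^ n) + 2 ^ 0 < 2 ^ (2 * 3 ^ n) := by
            have h1 : 2 ^ (3 ^ n + 1) ≤ 2 ^ (2 * 3 ^ n) :=
              Nat.pow_le_pow_right (by norm_num) (by omega)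
            have h2 : 2 ^ 1 ≤ 2 ^ (3 ^ n) := Nat.pow_le_pow_right (by norm_num) h3
            rw [pow_succ] at h1
            omega
          have := Nat.two_pow_add_eq_or_of_lt (i := 2 * 3 ^ n) hlt 1
          simpa using this.symm
        rw [e1, e2]; omega
      rw [hor, Nat.testBit_or, Nat.testBit_or, Nat.testBit_two_pow, Nat.testBit_two_pow,
        Nat.testBit_two_pow] at h
      simp only [Bool.or_eq_true, decide_eq_true_eq] at h
      rcases h with h | h | h
      · exact ⟨2, by norm_num, by omega⟩
      · exact ⟨1, by norm_num, by omega⟩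
      · exact ⟨0, by norm_num, by omega⟩

theorem div_mod_eq (a b c : ℕ) : a / b % c = a % (b * c) / b := by
  rw [Nat.mod_mul_right_div_self]

theorem digits_of_testBit_nbrs {v n u : ℕ} (h : (nbrs n v).testBit u) :
    ∃ i < n, u / 3 ^ i % 3 ≠ v / 3 ^ i % 3 ∧ ∀ j, j ≠ i → u / 3 ^ j % 3 = v / 3 ^ j % 3 := by
  obtain ⟨h1, hne⟩ := testBit_eraseBit h
  obtain ⟨i, hi, t, ht, hu⟩ := exists_of_testBit_lines h1
  have h3 : 0 < 3 ^ i := by positivity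
  have hmod : u % 3 ^ i = v % 3 ^ i := by
    rw [hu, pow_succ, show v / (3 ^ i * 3) * (3 ^ i * 3) + v % 3 ^ i + t * 3 ^ i =
      v % 3 ^ i + 3 ^ i * (v / (3 ^ i * 3) * 3 + t) by ring, Nat.add_mul_mod_self_left, Nat.mod_mod]
  have hdiv : u / 3 ^ i = v / 3 ^ (i + 1) * 3 + t := by
    rw [hu, show v / 3 ^ (i + 1) * 3 ^ (i + 1) + v % 3 ^ i + t * 3 ^ i =
      v % 3 ^ i + 3 ^ i * (v / 3 ^ (i + 1) * 3 + t) by ring, Nat.add_mul_div_left _ _ h3,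
      Nat.div_eq_of_lt (Nat.mod_lt _ h3), zero_add]
  have hdiv' : u / 3 ^ (i + 1) = v / 3 ^ (i + 1) := by
    rw [pow_succ, ← Nat.div_div_eq_div_mul, hdiv, ← pow_succ]; omega
  refine ⟨i, hi, fun h0 => hne ?_, fun j hj => ?_⟩
  · have e1 : u / 3 ^ i = v / 3 ^ i := by
      rw [← Nat.div_add_mod (u / 3 ^ i) 3, ← Nat.div_add_mod (v / 3 ^ i) 3, h0,
        Nat.div_div_eq_div_mul, Nat.div_div_eq_div_mul, ← pow_succ, hdiv']
    rw [← Nat.div_add_mod u (3 ^ i), ← Nat.div_add_mod v (3 ^ i), e1, hmod]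
  · rcases lt_or_gt_of_ne hj with hlt | hgt
    · have hd : 3 ^ j * 3 ∣ 3 ^ i := by rw [← pow_succ]; exact pow_dvd_pow _ (by omega)
      rw [div_mod_eq, div_mod_eq, ← Nat.mod_mod_of_dvd u hd, hmod,
        Nat.mod_mod_of_dvd v hd]
    · obtain ⟨k, rfl⟩ := Nat.exists_eq_add_of_lt hgt
      rw [show i + k + 1 = i + 1 + k by ring, pow_add, ← Nat.div_div_eq_div_mul,
        ← Nat.div_div_eq_div_mul, hdiv']

theorem lineAdj_digitPoint {d v u : ℕ} (h : (nbrs (d + 1) v).testBit u) :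
    LineAdj (digitPoint d v) (digitPoint d u) := by
  obtain ⟨i, hi, hne, heq⟩ := digits_of_testBit_nbrs h
  have hcast : ∀ a b : ℕ, (a : ZMod 3) = b ↔ a % 3 = b % 3 := fun a b =>
    ZMod.natCast_eq_natCast_iff' a b 3
  rcases Nat.lt_succ_iff_lt_or_eq.mp hi with hlt | rfl
  · refine ⟨fun h0 => hne ?_, some ⟨i, hlt⟩, fun o ho => ?_⟩
    · exact ((hcast _ _).mp (congrFun h0 (some ⟨i, hlt⟩))).symm
    · rcases o with _ | j
      · exact (hcast _ _).mpr (heq d (by omega)).symm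
      · refine (hcast _ _).mpr (heq j fun h0 => ho ?_).symm
        simp [Fin.ext_iff, h0]
  · refine ⟨fun h0 => hne ?_, none, fun o ho => ?_⟩
    · exact ((hcast _ _).mp (congrFun h0 none)).symm
    · rcases o with _ | j
      · exact absurd rfl ho
      · exact (hcast _ _).mpr (heq j (by omega)).symm

theorem exists_mem_block (b : Block) (c : ZMod 3) :
    c ∈ b.toFinset ∨ c + 1 ∈ b.toFinset ∨ c + 2 ∈ b.toFinset := by
  revert c; cases b <;> decide

theorem lt_of_testBit_nbrs {v n u : ℕ} (hv : v < 3 ^ n) (h : (nbrs n v).testBit u) : u < 3 ^ n := by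
  obtain ⟨i, hi, t, ht, hu⟩ := exists_of_testBit_lines (testBit_eraseBit h).1
  obtain ⟨k, rfl⟩ := Nat.exists_eq_add_of_lt hi
  have h3 : 0 < 3 ^ i := by positivity
  have h1 : v / 3 ^ (i + 1) < 3 ^ k := by
    rw [Nat.div_lt_iff_lt_mul (by positivity), ← pow_add]
    convert hv using 2; ring
  have h2 := Nat.mod_lt v h3
  have h4 : (v / 3 ^ (i + 1) + 1) * 3 ^ (i + 1) ≤ 3 ^ k * 3 ^ (i + 1) := Nat.mul_le_mul_right _ h1
  have h5 : t * 3 ^ i ≤ 2 * 3 ^ i := Nat.mul_le_mul_right _ (by omega)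
  rw [show i + k + 1 = k + (i + 1) by ring, pow_add]
  rw [add_mul, one_mul] at h4
  have h6 : 3 ^ (i + 1) = 3 * 3 ^ i := by ring
  omega

theorem eq_of_digits (n : ℕ) {a b : ℕ} (ha : a < 3 ^ n) (hb : b < 3 ^ n)
    (h : ∀ j < n, a / 3 ^ j % 3 = b / 3 ^ j % 3) : a = b := by
  induction n generalizing a b with
  | zero => simp at ha hb; omega
  | succ n ih =>
    have h1 : a / 3 = b / 3 := by
      refine ih (by rw [pow_succ] at ha; omega) (by rw [pow_succ] at hb; omega) fun j hj => ?_
      rw [Nat.div_div_eq_div_mul, Nat.div_div_eq_div_mul, ← pow_succ']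
      exact h (j + 1) (by omega)
    have h2 := h 0 (by omega)
    simp at h2
    omega

theorem digitPoint_injOn {d a b : ℕ} (ha : a < 3 ^ (d + 1)) (hb : b < 3 ^ (d + 1))
    (h : digitPoint d a = digitPoint d b) : a = b := by
  refine eq_of_digits (d + 1) ha hb fun j hj => ?_
  rcases Nat.lt_succ_iff_lt_or_eq.mp hj with hlt | rfl
  · exact (ZMod.natCast_eq_natCast_iff' _ _ 3).mp (congrFun h (some ⟨j, hlt⟩))
  · exact (ZMod.natCast_eq_natCast_iff' _ _ 3).mp (congrFun h none)

theorem digitPoint_add_mul {d v c : ℕ} (i : Fin d) :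
    digitPoint d (c * 3 ^ d + v) (some i) = digitPoint d v (some i) := by
  refine (ZMod.natCast_eq_natCast_iff' _ _ 3).mpr ?_
  obtain ⟨k, hk⟩ := Nat.exists_eq_add_of_lt i.2
  have h3 : 0 < 3 ^ (i : ℕ) := by positivity
  have h : c * 3 ^ d + v = v + 3 ^ (i : ℕ) * (3 * (c * 3 ^ k)) := by
    conv_lhs => rw [hk]
    ring
  rw [h, Nat.add_mul_div_left _ _ h3, Nat.add_mul_mod_self_left]

theorem digitPoint_add_mul_none {d v c : ℕ} :
    digitPoint d (c * 3 ^ d + v) none = digitPoint d v none + c := by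
  simp only [digitPoint]
  rw [add_comm, Nat.add_mul_div_right _ _ (by positivity)]
  push_cast; rfl

theorem digitPoint_mod {d v : ℕ} : digitPoint d (v % (3 * 3 ^ d)) = digitPoint d v := by
  funext o
  rcases o with _ | i
  · refine (ZMod.natCast_eq_natCast_iff' _ _ 3).mpr ?_
    rw [mul_comm, ← div_mod_eq, Nat.mod_mod]
  · refine (ZMod.natCast_eq_natCast_iff' _ _ 3).mpr ?_
    have hd : 3 ^ (i : ℕ) * 3 ∣ 3 * 3 ^ d := by
      rw [← pow_succ, ← pow_succ']; exact pow_dvd_pow _ (by omega)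
    rw [div_mod_eq, div_mod_eq, Nat.mod_mod_of_dvd _ hd]

theorem mem_blockSet_digitPoint_cases {d : ℕ} (f : (Fin d → ZMod 3) → Block) (v : ℕ) :
    digitPoint d v ∈ blockSet f ∨ digitPoint d (3 ^ d + v) ∈ blockSet f ∨
      digitPoint d (2 * 3 ^ d + v) ∈ blockSet f := by
  have h := exists_mem_block (f fun i => digitPoint d v (some i)) (digitPoint d v none)
  have h1 : 3 ^ d + v = 1 * 3 ^ d + v := by ring
  rw [h1]
  simp only [blockSet, Set.mem_ofPred_eq, digitPoint_add_mul, digitPoint_add_mul_none]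
  simpa using h

theorem sound_of_good {d : ℕ} {f : (Fin d → ZMod 3) → Block} (h : Good f) :
    Sound d (3 ^ d) (3 * 3 ^ d) (fun v => digitPoint d v ∈ blockSet f)
      fun v u => LineAdj (digitPoint d v) (digitPoint d u) where
  nbrs v u hv hu := by
    rw [← pow_succ'] at hv ⊢
    exact ⟨lt_of_testBit_nbrs hv hu, lineAdj_digitPoint hu⟩
  symm _ _ := LineAdj.symm
  unique c a b ha' hb' hc ha hb hca hcb := by
    rw [← pow_succ'] at ha' hb'
    exact digitPoint_injOn ha' hb' (h _ hc _ ha _ hb hca hcb)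
  cell := mem_blockSet_digitPoint_cases f
  -- Reduction modulo `3 * 3 ^ d` only wraps the additional coordinate around, so these are again
  -- the three points of one cell.
  forced v := by
    rw [digitPoint_mod, digitPoint_mod, add_comm v, add_comm v]
    exact mem_blockSet_digitPoint_cases f v

end BitSearch

/-! ### Types of pairs of coordinates -/

/-- The values at `a e_i + b e_j` form a checkerboard. -/
def Chk {ι : Type*} [DecidableEq ι] (f : (ι → ZMod 3) → Block) (s : ZMod 3) (i j : ι) : Prop :=
  ∀ a b : ZMod 3, a ≠ 0 → b ≠ 0 → s * a * b ∈ (f (Pi.single i a + Pi.single j b)).toFinset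

/-- The value at `a e_i + b e_j` is `s a`. -/
def Dom {ι : Type*} [DecidableEq ι] (f : (ι → ZMod 3) → Block) (s : ZMod 3) (i j : ι) : Prop :=
  ∀ a b : ZMod 3, a ≠ 0 → b ≠ 0 → s * a ∈ (f (Pi.single i a + Pi.single j b)).toFinset

/-- The coordinates `i` and `j` form a checkerboard. -/
def Checkered {ι : Type*} [DecidableEq ι] (f : (ι → ZMod 3) → Block) (i j : ι) : Prop :=
  ∃ s : ZMod 3, s ≠ 0 ∧ Chk f s i j

/-- The coordinate `i` dominates `j`. -/
def Dominates {ι : Type*} [DecidableEq ι] (f : (ι → ZMod 3) → Block) (i j : ι) : Prop :=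
  ∃ s : ZMod 3, s ≠ 0 ∧ Dom f s i j

theorem ZMod.three_cases {s : ZMod 3} (hs : s ≠ 0) : s = (1 : ℕ) ∨ s = (2 : ℕ) := by
  revert s; decide

section
variable {ι κ : Type*} [DecidableEq ι] [DecidableEq κ] {f : (ι → ZMod 3) → Block}

theorem Chk.symm {s : ZMod 3} {i j : ι} (h : Chk f s i j) : Chk f s j i := fun a b ha hb => by
  rw [add_comm, mul_right_comm]; exact h b a hb ha

theorem Checkered.symm {i j : ι} (h : Checkered f i j) : Checkered f j i :=
  h.imp fun _ hs => ⟨hs.1, hs.2.symm⟩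

theorem extendZero_single_add {e : κ → ι} (he : Function.Injective e) (i j : κ) (a b : ZMod 3) :
    extendZero e (Pi.single i a + Pi.single j b) = Pi.single (e i) a + Pi.single (e j) b := by
  funext x
  by_cases hx : ∃ k, e k = x
  · obtain ⟨k, rfl⟩ := hx
    rw [extendZero_apply he]
    simp [Pi.single_apply, he.eq_iff]
  · rw [extendZero_of_notMem _ hx, Pi.add_apply, Pi.single_eq_of_ne, Pi.single_eq_of_ne, add_zero]
    · exact fun h => hx ⟨j, h.symm⟩
    · exact fun h => hx ⟨i, h.symm⟩

theorem chk_extendZero {e : κ → ι} (he : Function.Injective e) {s : ZMod 3} {i j : κ} :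
    Chk (f ∘ extendZero e) s i j ↔ Chk f s (e i) (e j) := by
  simp only [Chk, Function.comp, extendZero_single_add he]

theorem dom_extendZero {e : κ → ι} (he : Function.Injective e) {s : ZMod 3} {i j : κ} :
    Dom (f ∘ extendZero e) s i j ↔ Dom f s (e i) (e j) := by
  simp only [Dom, Function.comp, extendZero_single_add he]

theorem checkered_extendZero {e : κ → ι} (he : Function.Injective e) {i j : κ} :
    Checkered (f ∘ extendZero e) i j ↔ Checkered f (e i) (e j) := by
  simp only [Checkered, chk_extendZero he]

theorem dominates_extendZero {e : κ → ι} (he : Function.Injective e) {i j : κ} :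
    Dominates (f ∘ extendZero e) i j ↔ Dominates f (e i) (e j) := by
  simp only [Dominates, dom_extendZero he]

end

theorem extendZero_block_zero {ι κ : Type*} {f : (ι → ZMod 3) → Block} (e : κ → ι)
    (h0 : f 0 = Block.X) : (f ∘ extendZero e) 0 = Block.X := by
  rw [Function.comp, extendZero_zero, h0]

/-! ### Types of pairs as alternatives for the search -/

namespace BitSearch

/-- The index of the point with digits `a` and `b` at `i < j` and additional coordinate `c`. -/
def pairIndex (d i j a b c : ℕ) : ℕ := a * 3 ^ i + b * 3 ^ j + c * 3 ^ d

theorem digit_add {x t i k : ℕ} (hx : x < 3 ^ i) (ht : t < 3) :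
    (x + t * 3 ^ i) / 3 ^ k % 3 = if k = i then t else x / 3 ^ k % 3 := by
  have hi : 0 < 3 ^ i := by positivity
  split_ifs with h
  · subst h
    rw [Nat.add_mul_div_right _ _ hi, Nat.div_eq_of_lt hx, zero_add, Nat.mod_eq_of_lt ht]
  · rcases lt_or_gt_of_ne h with h | h
    · obtain ⟨m, rfl⟩ := Nat.exists_eq_add_of_lt h
      rw [show x + t * 3 ^ (k + m + 1) = x + 3 ^ k * (3 * (t * 3 ^ m)) by ring,
        Nat.add_mul_div_left _ _ (by positivity), Nat.add_mul_mod_self_left]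
    · have h1 : 3 ^ (i + 1) ≤ 3 ^ k := Nat.pow_le_pow_right (by norm_num) h
      have h2 : t * 3 ^ i ≤ 2 * 3 ^ i := Nat.mul_le_mul_right _ (by omega)
      rw [pow_succ] at h1
      rw [Nat.div_eq_of_lt (by omega), Nat.div_eq_of_lt (by omega)]

theorem digit_pairIndex {d i j a b c : ℕ} (hij : i < j) (hj : j < d) (ha : a < 3) (hb : b < 3)
    (hc : c < 3) (k : ℕ) : pairIndex d i j a b c / 3 ^ k % 3 =
      if k = d then c else if k = j then b else if k = i then a else 0 := by
  have key : ∀ {x t i l}, x < 3 ^ i → t < 3 → i < l → x + t * 3 ^ i < 3 ^ l := by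
    intro x t i l hx ht hl
    have h1 : 3 ^ (i + 1) ≤ 3 ^ l := Nat.pow_le_pow_right (by norm_num) hl
    have h2 : t * 3 ^ i ≤ 2 * 3 ^ i := Nat.mul_le_mul_right _ (by omega)
    rw [pow_succ] at h1
    omega
  have h1 : 0 + a * 3 ^ i < 3 ^ j := key (by positivity) ha hij
  have h2 : 0 + a * 3 ^ i + b * 3 ^ j < 3 ^ d := key h1 hb hj
  rw [pairIndex, ← zero_add (a * 3 ^ i), digit_add h2 hc, digit_add h1 hb,
    digit_add (by positivity) ha]
  simp

theorem mem_pairIndex {d : ℕ} {f : (Fin d → ZMod 3) → Block} {i j : Fin d} (hij : i < j) {a b c : ℕ}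
    (ha : a < 3) (hb : b < 3)
    (h : (c : ZMod 3) ∈ (f (Pi.single i (a : ZMod 3) + Pi.single j (b : ZMod 3))).toFinset) :
    digitPoint d (pairIndex d i j a b (c % 3)) ∈ blockSet f := by
  have hd := digit_pairIndex (d := d) (c := c % 3) hij j.2 ha hb (Nat.mod_lt _ (by norm_num))
  have h1 : digitPoint d (pairIndex d i j a b (c % 3)) none = c := by
    refine (ZMod.natCast_eq_natCast_iff' _ _ 3).mpr ?_
    rw [hd, if_pos rfl]
  have h2 : (fun k => digitPoint d (pairIndex d i j a b (c % 3)) (some k)) =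
      Pi.single i (a : ZMod 3) + Pi.single j (b : ZMod 3) := by
    funext k
    have h3 : digitPoint d (pairIndex d i j a b (c % 3)) (some k) =
        ((pairIndex d i j a b (c % 3) / 3 ^ (k : ℕ) % 3 : ℕ) : ZMod 3) :=
      (ZMod.natCast_eq_natCast_iff' _ _ 3).mpr (by rw [Nat.mod_mod])
    rw [h3, hd, if_neg k.2.ne, Pi.add_apply, Pi.single_apply, Pi.single_apply]
    simp only [Fin.ext_iff]
    have := Fin.lt_def.mp hij
    by_cases hkj : (k : ℕ) = j
    · rw [if_pos hkj, if_pos hkj, if_neg (by omega), zero_add]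
    · by_cases hki : (k : ℕ) = i
      · rw [if_neg hkj, if_neg hkj, if_pos hki, if_pos hki, add_zero]
      · rw [if_neg hkj, if_neg hkj, if_neg hki, if_neg hki]; simp
  change digitPoint d (pairIndex d i j a b (c % 3)) none ∈
    (f fun k => digitPoint d (pairIndex d i j a b (c % 3)) (some k)).toFinset
  rw [h1, h2]
  exact h

/-- The four points with value `g a b` at `a e_i + b e_j`. -/
def pairAlt (d i j : ℕ) (g : ℕ → ℕ → ℕ) : List ℕ :=
  [pairIndex d i j 1 1 (g 1 1 % 3), pairIndex d i j 1 2 (g 1 2 % 3),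
    pairIndex d i j 2 1 (g 2 1 % 3), pairIndex d i j 2 2 (g 2 2 % 3)]

/-- All points of the list belong to the set corresponding to `f`. -/
def Holds {d : ℕ} (f : (Fin d → ZMod 3) → Block) (alt : List ℕ) : Prop :=
  ∀ v ∈ alt, digitPoint d v ∈ blockSet f

section
variable {d : ℕ} {f : (Fin d → ZMod 3) → Block} {i j : Fin d}

theorem holds_pairAlt (hij : i < j) (g : ℕ → ℕ → ℕ)
    (h : ∀ a b : ℕ, a < 3 → b < 3 → a ≠ 0 → b ≠ 0 →
      (g a b : ZMod 3) ∈ (f (Pi.single i (a : ZMod 3) + Pi.single j (b : ZMod 3))).toFinset) :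
    Holds f (pairAlt d i j g) := by
  intro v hv
  simp only [pairAlt, List.mem_cons, List.not_mem_nil, or_false] at hv
  rcases hv with rfl | rfl | rfl | rfl <;>
    exact mem_pairIndex hij (by norm_num) (by norm_num)
      (h _ _ (by norm_num) (by norm_num) (by norm_num) (by norm_num))

theorem natCast_ne_zero {a : ℕ} (ha : a < 3) (h0 : a ≠ 0) : (a : ZMod 3) ≠ 0 := by
  interval_cases a
  · exact absurd rfl h0
  · decide
  · decide

theorem holds_chk {s : ℕ} (hij : i < j) (h : Chk f s i j) :
    Holds f (pairAlt d i j fun a b => s * a * b) :=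
  holds_pairAlt hij _ fun a b ha hb ha0 hb0 => by
    push_cast; exact h a b (natCast_ne_zero ha ha0) (natCast_ne_zero hb hb0)

theorem holds_dom {s : ℕ} (hij : i < j) (h : Dom f s i j) :
    Holds f (pairAlt d i j fun a _ => s * a) :=
  holds_pairAlt hij _ fun a b ha hb ha0 hb0 => by
    push_cast; exact h a b (natCast_ne_zero ha ha0) (natCast_ne_zero hb hb0)

theorem holds_dom_swap {s : ℕ} (hij : i < j) (h : Dom f s j i) :
    Holds f (pairAlt d i j fun _ b => s * b) :=
  holds_pairAlt hij _ fun a b ha hb ha0 hb0 => by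
    push_cast; rw [add_comm]; exact h b a (natCast_ne_zero hb hb0) (natCast_ne_zero ha ha0)

/-- The alternatives for a checkerboard at `i < j`. -/
def chkLevel (d i j : ℕ) : List (List ℕ) :=
  [pairAlt d i j fun a b => 1 * a * b, pairAlt d i j fun a b => 2 * a * b]

/-- The alternatives for `i < j` with `i` dominating. -/
def domLevel (d i j : ℕ) : List (List ℕ) :=
  [pairAlt d i j fun a _ => 1 * a, pairAlt d i j fun a _ => 2 * a]

/-- The alternatives for `i < j` with `j` dominating. -/
def domSwapLevel (d i j : ℕ) : List (List ℕ) :=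
  [pairAlt d i j fun _ b => 1 * b, pairAlt d i j fun _ b => 2 * b]

theorem exists_chkLevel (hij : i < j) (h : Checkered f i j) :
    ∃ alt ∈ chkLevel d i j, Holds f alt := by
  obtain ⟨s, hs, h⟩ := h
  rcases ZMod.three_cases hs with rfl | rfl
  · exact ⟨_, by simp [chkLevel], holds_chk hij h⟩
  · exact ⟨_, by simp [chkLevel], holds_chk hij h⟩

theorem exists_domLevel (hij : i < j) (h : Dominates f i j) :
    ∃ alt ∈ domLevel d i j, Holds f alt := by
  obtain ⟨s, hs, h⟩ := h
  rcases ZMod.three_cases hs with rfl | rfl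
  · exact ⟨_, by simp [domLevel], holds_dom hij h⟩
  · exact ⟨_, by simp [domLevel], holds_dom hij h⟩

theorem exists_domSwapLevel (hij : i < j) (h : Dominates f j i) :
    ∃ alt ∈ domSwapLevel d i j, Holds f alt := by
  obtain ⟨s, hs, h⟩ := h
  rcases ZMod.three_cases hs with rfl | rfl
  · exact ⟨_, by simp [domSwapLevel], holds_dom_swap hij h⟩
  · exact ⟨_, by simp [domSwapLevel], holds_dom_swap hij h⟩

theorem exists_append {L L' : List (List ℕ)}
    (h : (∃ alt ∈ L, Holds f alt) ∨ ∃ alt ∈ L', Holds f alt) : ∃ alt ∈ L ++ L', Holds f alt := by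
  rcases h with ⟨alt, ha, h⟩ | ⟨alt, ha, h⟩
  · exact ⟨alt, by simp [ha], h⟩
  · exact ⟨alt, by simp [ha], h⟩

/-- `refute` for functions with value `X` at zero. -/
def refuteX (d m : ℕ) (ls : List (List (List ℕ))) : Bool :=
  refute d m ([[3 ^ d, 2 * 3 ^ d]] :: ls)

/-- The indices `3 ^ d` and `2 * 3 ^ d` are the points `1` and `2` of `X` over the origin. -/
theorem false_of_refuteX {m : ℕ} (hf : Good f) (h0 : f 0 = Block.X) {ls : List (List (List ℕ))}
    (hr : refuteX d m ls = true) (hl : ∀ L ∈ ls, ∃ alt ∈ L, Holds f alt) : False := by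
  have hz : ∀ i : Fin d, digitPoint d 0 (some i) = 0 := fun i => by simp [digitPoint]
  have hX : ∀ c : ℕ, (c : ZMod 3) ∈ Block.X.toFinset → digitPoint d (c * 3 ^ d + 0) ∈ blockSet f := by
    intro c hc
    simp only [blockSet, Set.mem_ofPred_eq, digitPoint_add_mul, digitPoint_add_mul_none, hz]
    rw [show (fun _ : Fin d => (0 : ZMod 3)) = 0 from rfl, h0]
    simpa [digitPoint] using hc
  have := not_refute (m := m) (sound_of_good hf) ([[3 ^ d, 2 * 3 ^ d]] :: ls) ?_
  · rw [refuteX, this] at hr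
    cases hr
  · intro L hL
    rcases List.mem_cons.mp hL with rfl | hL
    · refine ⟨_, List.mem_singleton.mpr rfl, fun v hv => ?_⟩
      simp only [List.mem_cons, List.not_mem_nil, or_false] at hv
      rcases hv with rfl | rfl
      · simpa using hX 1 (by decide)
      · simpa using hX 2 (by decide)
    · exact hl L hL

end

end BitSearch

/-! ### The finite computations -/

namespace BitSearch

/-- Whether the four values `c₁₁, c₁₂, c₂₁, c₂₂` at `a e_i + b e_j` are given by a function `g`. -/
def isPattern (g : ℕ → ℕ → ℕ) (c₁₁ c₁₂ c₂₁ c₂₂ : ℕ) : Bool :=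
  c₁₁ == g 1 1 % 3 && c₁₂ == g 1 2 % 3 && c₂₁ == g 2 1 % 3 && c₂₂ == g 2 2 % 3

/-- Whether the four values form one of the six possible patterns. -/
def isSomePattern (c₁₁ c₁₂ c₂₁ c₂₂ : ℕ) : Bool :=
  isPattern (fun a b => 1 * a * b) c₁₁ c₁₂ c₂₁ c₂₂ ||
  isPattern (fun a b => 2 * a * b) c₁₁ c₁₂ c₂₁ c₂₂ ||
  isPattern (fun a _ => 1 * a) c₁₁ c₁₂ c₂₁ c₂₂ || isPattern (fun a _ => 2 * a) c₁₁ c₁₂ c₂₁ c₂₂ ||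
  isPattern (fun _ b => 1 * b) c₁₁ c₁₂ c₂₁ c₂₂ || isPattern (fun _ b => 2 * b) c₁₁ c₁₂ c₂₁ c₂₂

/-- Of the 81 choices of one value at each of the four points, those other than the six patterns
contradict `X` at the origin. -/
theorem refute_two : ∀ c₁₁ < 3, ∀ c₁₂ < 3, ∀ c₂₁ < 3, ∀ c₂₂ < 3,
    isSomePattern c₁₁ c₁₂ c₂₁ c₂₂ = true ∨
      refuteX 2 2 [[[pairIndex 2 0 1 1 1 (c₁₁ % 3), pairIndex 2 0 1 1 2 (c₁₂ % 3),
        pairIndex 2 0 1 2 1 (c₂₁ % 3), pairIndex 2 0 1 2 2 (c₂₂ % 3)]]] = true := by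
  decide +kernel

theorem refute_cycle : refuteX 3 3 [domLevel 3 0 1, domLevel 3 1 2, domSwapLevel 3 0 2] = true := by
  decide +kernel

/-- A coordinate cannot dominate two others with opposite signs when the first of these dominates
the second. -/
theorem refute_signs :
    refuteX 3 3 [[pairAlt 3 0 1 fun a _ => 1 * a], [pairAlt 3 0 2 fun a _ => 2 * a],
      domLevel 3 1 2] = true ∧
    refuteX 3 3 [[pairAlt 3 0 1 fun a _ => 2 * a], [pairAlt 3 0 2 fun a _ => 1 * a],
      domLevel 3 1 2] = true := by
  decide +kernel

/-- The alternatives for a pair `i < j` that is not a checkerboard. -/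
def nonChkLevel (d i j : ℕ) : List (List ℕ) := domLevel d i j ++ domSwapLevel d i j

/-- Checkered pairs `01`, `23` and non-checkered pairs `02`, `13` form an alternating four-cycle;
the two diagonals may have any type. -/
theorem refute_alternating :
    refuteX 4 4 [chkLevel 4 0 1, chkLevel 4 2 3, nonChkLevel 4 0 2, nonChkLevel 4 1 3,
      chkLevel 4 0 3 ++ nonChkLevel 4 0 3, chkLevel 4 1 2 ++ nonChkLevel 4 1 2] = true := by
  decide +kernel

/-- The sign encoded by a Boolean, as a natural number. -/
def sgn (b : Bool) : ℕ := bif b then 1 else 2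

/-- The alternative for a checkerboard with given sign. -/
def chkAlt (d i j : ℕ) (b : Bool) : List ℕ := pairAlt d i j fun a c => sgn b * a * c

/-- Whether the four triangles of a signed complete graph on four vertices have the same sign. -/
def even (b₀₁ b₀₂ b₀₃ b₁₂ b₁₃ b₂₃ : Bool) : Bool :=
  (b₀₁ ^^ b₀₂ ^^ b₁₂) == (b₀₁ ^^ b₀₃ ^^ b₁₃) && (b₀₁ ^^ b₀₂ ^^ b₁₂) == (b₀₂ ^^ b₀₃ ^^ b₂₃) &&
    (b₀₁ ^^ b₀₂ ^^ b₁₂) == (b₁₂ ^^ b₁₃ ^^ b₂₃)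

/-- Each edge lies in two triangles, so the number of negative triangles is even. What survives is
exactly two of each sign. -/
theorem refute_even : ∀ b₀₁ b₀₂ b₀₃ b₁₂ b₁₃ b₂₃ : Bool, even b₀₁ b₀₂ b₀₃ b₁₂ b₁₃ b₂₃ = true →
    refuteX 4 3 [[chkAlt 4 0 1 b₀₁], [chkAlt 4 0 2 b₀₂], [chkAlt 4 1 2 b₁₂], [chkAlt 4 0 3 b₀₃],
      [chkAlt 4 1 3 b₁₃], [chkAlt 4 2 3 b₂₃]] = true := by
  decide +kernel

/-- Signs of the edges of the complete graph on six vertices, those at the last vertex being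
positive. -/
def edgeSign (b₀₁ b₀₂ b₀₃ b₀₄ b₁₂ b₁₃ b₁₄ b₂₃ b₂₄ b₃₄ : Bool) : ℕ → ℕ → Bool
  | 0, 1 => b₀₁
  | 0, 2 => b₀₂
  | 0, 3 => b₀₃
  | 0, 4 => b₀₄
  | 1, 2 => b₁₂
  | 1, 3 => b₁₃
  | 1, 4 => b₁₄
  | 2, 3 => b₂₃
  | 2, 4 => b₂₄
  | 3, 4 => b₃₄
  | _, _ => true

/-- The quadruples of indices less than six. -/
def quadruples : List (ℕ × ℕ × ℕ × ℕ) :=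
  [(0, 1, 2, 3), (0, 1, 2, 4), (0, 1, 2, 5), (0, 1, 3, 4), (0, 1, 3, 5), (0, 1, 4, 5), (0, 2, 3, 4),
    (0, 2, 3, 5), (0, 2, 4, 5), (0, 3, 4, 5), (1, 2, 3, 4), (1, 2, 3, 5), (1, 2, 4, 5), (1, 3, 4, 5),
    (2, 3, 4, 5)]

/-- Whether some quadruple is `even`. -/
def hasEven (p : ℕ → ℕ → Bool) : Bool :=
  quadruples.any fun q => even (p q.1 q.2.1) (p q.1 q.2.2.1) (p q.1 q.2.2.2) (p q.2.1 q.2.2.1)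
    (p q.2.1 q.2.2.2) (p q.2.2.1 q.2.2.2)

/-- The alternatives for checkerboards with given signs at all pairs of six coordinates. -/
def sixLevels (p : ℕ → ℕ → Bool) : List (List (List ℕ)) :=
  [[chkAlt 6 0 1 (p 0 1)], [chkAlt 6 0 2 (p 0 2)], [chkAlt 6 0 3 (p 0 3)], [chkAlt 6 0 4 (p 0 4)],
    [chkAlt 6 0 5 (p 0 5)], [chkAlt 6 1 2 (p 1 2)], [chkAlt 6 1 3 (p 1 3)], [chkAlt 6 1 4 (p 1 4)],
    [chkAlt 6 1 5 (p 1 5)], [chkAlt 6 2 3 (p 2 3)], [chkAlt 6 2 4 (p 2 4)], [chkAlt 6 2 5 (p 2 5)],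
    [chkAlt 6 3 4 (p 3 4)], [chkAlt 6 3 5 (p 3 5)], [chkAlt 6 4 5 (p 4 5)]]

/-- The symmetric extension of the signs of the pairs `i < j`. -/
def symSign (p : ℕ → ℕ → Bool) (i j : ℕ) : Bool := bif Nat.blt i j then p i j else p j i

/-- Whether the negative edges between `0`, `a`, `b`, `c`, `d` are those of the pentagon with this
order of vertices. -/
def isPentagon (p : ℕ → ℕ → Bool) (a b c d : ℕ) : Bool :=
  [0, a, b, c, d].Nodup &&
    !symSign p 0 a && !symSign p a b && !symSign p b c && !symSign p c d && !symSign p 0 d &&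
    symSign p 0 b && symSign p b d && symSign p a d && symSign p a c && symSign p 0 c

/-- With positive edges at the last vertex, a quadruple containing it is `even` exactly if its other
three vertices span a monochromatic triangle. The only two-colouring of the edges of `K₅` without
such a triangle is the pentagon with its complement. -/
theorem exists_pentagon : ∀ b₀₁ b₀₂ b₀₃ b₀₄ b₁₂ b₁₃ b₁₄ b₂₃ b₂₄ b₃₄ : Bool,
    hasEven (edgeSign b₀₁ b₀₂ b₀₃ b₀₄ b₁₂ b₁₃ b₁₄ b₂₃ b₂₄ b₃₄) = true ∨
      ∃ a < 5, ∃ b < 5, ∃ c < 5, ∃ d < 5,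
        isPentagon (edgeSign b₀₁ b₀₂ b₀₃ b₀₄ b₁₂ b₁₃ b₁₄ b₂₃ b₂₄ b₃₄) a b c d = true := by
  decide +kernel

/-- The signs with the pentagon `0, 1, 2, 3, 4` as negative edges. -/
def pentagonSign : ℕ → ℕ → Bool :=
  edgeSign false true true false false true true false true false

theorem refute_six : refuteX 6 4 (sixLevels pentagonSign) = true := by
  decide +kernel

end BitSearch

open BitSearch

/-! ### Consequences in dimensions two, three, four and six -/

section FinDimensional

theorem trichotomy_fin {f : (Fin 2 → ZMod 3) → Block} (hf : Good f) (h0 : f 0 = Block.X) :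
    Checkered f 0 1 ∨ Dominates f 0 1 ∨ Dominates f 1 0 := by
  -- One element of each block suffices: the search needs only points known to be present.
  have hex : ∀ x, ∃ c : ℕ, c < 3 ∧ (c : ZMod 3) ∈ (f x).toFinset := fun x => by
    cases f x
    · exact ⟨0, by decide⟩
    · exact ⟨1, by decide⟩
    · exact ⟨2, by decide⟩
    · exact ⟨1, by decide⟩
    · exact ⟨0, by decide⟩
    · exact ⟨0, by decide⟩
  choose c hc hcm using hex
  let v (a b : ℕ) : Fin 2 → ZMod 3 := Pi.single 0 (a : ZMod 3) + Pi.single 1 (b : ZMod 3)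
  have hpat : ∀ {g : ℕ → ℕ → ℕ}, isPattern g (c (v 1 1)) (c (v 1 2)) (c (v 2 1)) (c (v 2 2)) = true →
      ∀ a b : ZMod 3, a ≠ 0 → b ≠ 0 → ∃ a' b' : ℕ, (a' : ZMod 3) = a ∧ (b' : ZMod 3) = b ∧
        (g a' b' : ZMod 3) ∈ (f (Pi.single 0 a + Pi.single 1 b)).toFinset := by
    intro g hg a b ha hb
    simp only [isPattern, Bool.and_eq_true, beq_iff_eq] at hg
    obtain ⟨⟨⟨h11, h12⟩, h21⟩, h22⟩ := hg
    have hm : ∀ a b : ℕ, c (v a b) = g a b % 3 → (g a b : ZMod 3) ∈ (f (v a b)).toFinset := by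
      intro a b h
      have h1 : ((c (v a b) : ℕ) : ZMod 3) = (g a b : ZMod 3) := by
        rw [h]; exact ZMod.natCast_mod _ 3
      rw [← h1]; exact hcm _
    rcases ZMod.three_cases ha with rfl | rfl <;> rcases ZMod.three_cases hb with rfl | rfl
    · exact ⟨1, 1, rfl, rfl, hm 1 1 h11⟩
    · exact ⟨1, 2, rfl, rfl, hm 1 2 h12⟩
    · exact ⟨2, 1, rfl, rfl, hm 2 1 h21⟩
    · exact ⟨2, 2, rfl, rfl, hm 2 2 h22⟩
  have h1 : (1 : ZMod 3) ≠ 0 := by decide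
  have h2 : (2 : ZMod 3) ≠ 0 := by decide
  rcases refute_two _ (hc (v 1 1)) _ (hc (v 1 2)) _ (hc (v 2 1)) _ (hc (v 2 2)) with h | h
  · simp only [isSomePattern, Bool.or_eq_true] at h
    rcases h with ((((h | h) | h) | h) | h) | h
    · refine Or.inl ⟨1, h1, fun a b ha hb => ?_⟩
      obtain ⟨a', b', rfl, rfl, h⟩ := hpat h a b ha hb
      simpa using h
    · refine Or.inl ⟨2, h2, fun a b ha hb => ?_⟩
      obtain ⟨a', b', rfl, rfl, h⟩ := hpat h a b ha hb
      simpa using h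
    · refine Or.inr (Or.inl ⟨1, h1, fun a b ha hb => ?_⟩)
      obtain ⟨a', b', rfl, rfl, h⟩ := hpat h a b ha hb
      simpa using h
    · refine Or.inr (Or.inl ⟨2, h2, fun a b ha hb => ?_⟩)
      obtain ⟨a', b', rfl, rfl, h⟩ := hpat h a b ha hb
      simpa using h
    · refine Or.inr (Or.inr ⟨1, h1, fun a b ha hb => ?_⟩)
      obtain ⟨a', b', rfl, rfl, h⟩ := hpat h b a hb ha
      rw [add_comm]; simpa using h
    · refine Or.inr (Or.inr ⟨2, h2, fun a b ha hb => ?_⟩)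
      obtain ⟨a', b', rfl, rfl, h⟩ := hpat h b a hb ha
      rw [add_comm]; simpa using h
  · refine (false_of_refuteX hf h0 h fun L hL => ?_).elim
    rw [List.mem_singleton.mp hL]
    refine ⟨_, List.mem_singleton.mpr rfl, fun x hx => ?_⟩
    simp only [List.mem_cons, List.not_mem_nil, or_false] at hx
    have h01 : (0 : Fin 2) < 1 := by decide
    rcases hx with rfl | rfl | rfl | rfl
    · exact mem_pairIndex h01 (by norm_num) (by norm_num) (hcm (v 1 1))
    · exact mem_pairIndex h01 (by norm_num) (by norm_num) (hcm (v 1 2))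
    · exact mem_pairIndex h01 (by norm_num) (by norm_num) (hcm (v 2 1))
    · exact mem_pairIndex h01 (by norm_num) (by norm_num) (hcm (v 2 2))

theorem exists_singleton {d : ℕ} {f : (Fin d → ZMod 3) → Block} {alt : List ℕ} (h : Holds f alt) :
    ∃ a ∈ [alt], Holds f a :=
  ⟨alt, List.mem_singleton.mpr rfl, h⟩

theorem not_cycle_fin {f : (Fin 3 → ZMod 3) → Block} (hf : Good f) (h0 : f 0 = Block.X)
    (h01 : Dominates f 0 1) (h12 : Dominates f 1 2) (h20 : Dominates f 2 0) : False := by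
  refine false_of_refuteX hf h0 refute_cycle ?_
  simp only [List.forall_mem_cons]
  exact ⟨exists_domLevel (i := 0) (j := 1) (by decide) h01,
    exists_domLevel (i := 1) (j := 2) (by decide) h12,
    exists_domSwapLevel (i := 0) (j := 2) (by decide) h20, by simp⟩

theorem not_signs_fin {f : (Fin 3 → ZMod 3) → Block} (hf : Good f) (h0 : f 0 = Block.X)
    {s t : ZMod 3} (hs : s ≠ 0) (ht : t ≠ 0) (hst : s ≠ t)
    (h01 : Dom f s 0 1) (h02 : Dom f t 0 2) (h12 : Dominates f 1 2) : False := by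
  have l01 : (0 : Fin 3) < 1 := by decide
  have l02 : (0 : Fin 3) < 2 := by decide
  have h12' := exists_domLevel (i := 1) (j := 2) (by decide) h12
  rcases ZMod.three_cases hs with rfl | rfl <;> rcases ZMod.three_cases ht with rfl | rfl
  · exact hst rfl
  · refine false_of_refuteX hf h0 refute_signs.1 ?_
    simp only [List.forall_mem_cons]
    exact ⟨exists_singleton (holds_dom l01 h01), exists_singleton (holds_dom l02 h02), h12', by simp⟩
  · refine false_of_refuteX hf h0 refute_signs.2 ?_
    simp only [List.forall_mem_cons]
    exact ⟨exists_singleton (holds_dom l01 h01), exists_singleton (holds_dom l02 h02), h12', by simp⟩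
  · exact hst rfl

theorem not_alternating_fin {f : (Fin 4 → ZMod 3) → Block} (hf : Good f) (h0 : f 0 = Block.X)
    (h01 : Checkered f 0 1) (h23 : Checkered f 2 3) (h02 : Dominates f 0 2 ∨ Dominates f 2 0)
    (h13 : Dominates f 1 3 ∨ Dominates f 3 1)
    (h03 : Checkered f 0 3 ∨ Dominates f 0 3 ∨ Dominates f 3 0)
    (h12 : Checkered f 1 2 ∨ Dominates f 1 2 ∨ Dominates f 2 1) : False := by
  have hD : ∀ {i j : Fin 4}, i < j → Dominates f i j ∨ Dominates f j i →
      ∃ alt ∈ nonChkLevel 4 i j, Holds f alt := fun hij h =>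
    exists_append (h.imp (exists_domLevel hij) (exists_domSwapLevel hij))
  have hA : ∀ {i j : Fin 4}, i < j → (Checkered f i j ∨ Dominates f i j ∨ Dominates f j i) →
      ∃ alt ∈ chkLevel 4 i j ++ nonChkLevel 4 i j, Holds f alt := fun hij h =>
    exists_append (h.imp (exists_chkLevel hij) (hD hij))
  refine false_of_refuteX hf h0 refute_alternating ?_
  simp only [List.forall_mem_cons]
  exact ⟨exists_chkLevel (i := 0) (j := 1) (by decide) h01,
    exists_chkLevel (i := 2) (j := 3) (by decide) h23, hD (i := 0) (j := 2) (by decide) h02,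
    hD (i := 1) (j := 3) (by decide) h13, hA (i := 0) (j := 3) (by decide) h03,
    hA (i := 1) (j := 2) (by decide) h12, by simp⟩

theorem not_even_fin {f : (Fin 4 → ZMod 3) → Block} (hf : Good f) (h0 : f 0 = Block.X)
    {b₀₁ b₀₂ b₀₃ b₁₂ b₁₃ b₂₃ : Bool} (he : BitSearch.even b₀₁ b₀₂ b₀₃ b₁₂ b₁₃ b₂₃ = true)
    (h01 : Chk f (sgn b₀₁) 0 1) (h02 : Chk f (sgn b₀₂) 0 2) (h03 : Chk f (sgn b₀₃) 0 3)
    (h12 : Chk f (sgn b₁₂) 1 2) (h13 : Chk f (sgn b₁₃) 1 3) (h23 : Chk f (sgn b₂₃) 2 3) : False := by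
  refine false_of_refuteX hf h0 (refute_even _ _ _ _ _ _ he) ?_
  simp only [List.forall_mem_cons]
  have hL : ∀ {i j : Fin 4} {b : Bool}, i < j → Chk f (sgn b) i j →
      ∃ a ∈ [chkAlt 4 i j b], Holds f a := fun hij h => exists_singleton (holds_chk hij h)
  exact ⟨hL (i := 0) (j := 1) (by decide) h01, hL (i := 0) (j := 2) (by decide) h02,
    hL (i := 1) (j := 2) (by decide) h12, hL (i := 0) (j := 3) (by decide) h03,
    hL (i := 1) (j := 3) (by decide) h13, hL (i := 2) (j := 3) (by decide) h23, by simp⟩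

theorem not_pentagon_fin {f : (Fin 6 → ZMod 3) → Block} (hf : Good f) (h0 : f 0 = Block.X)
    (h : ∀ i j : Fin 6, i < j → Chk f (sgn (pentagonSign i j)) i j) : False := by
  have hL : ∀ i j : Fin 6, i < j →
      ∃ alt ∈ [chkAlt 6 i j (pentagonSign i j)], Holds f alt := fun i j hij =>
    ⟨_, List.mem_singleton.mpr rfl, holds_chk hij (h i j hij)⟩
  refine false_of_refuteX hf h0 refute_six ?_
  rw [sixLevels]
  simp only [List.forall_mem_cons]
  exact ⟨hL 0 1 (by decide), hL 0 2 (by decide), hL 0 3 (by decide), hL 0 4 (by decide),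
    hL 0 5 (by decide), hL 1 2 (by decide), hL 1 3 (by decide), hL 1 4 (by decide),
    hL 1 5 (by decide), hL 2 3 (by decide), hL 2 4 (by decide), hL 2 5 (by decide),
    hL 3 4 (by decide), hL 3 5 (by decide), hL 4 5 (by decide), by simp⟩

end FinDimensional

/-! ### Transport to arbitrary coordinates -/

theorem injective_two {ι : Type*} {i j : ι} (h : i ≠ j) : Function.Injective ![i, j] := by
  intro a b; fin_cases a <;> fin_cases b <;> simp [h, h.symm]

theorem injective_three {ι : Type*} {i j k : ι} (hij : i ≠ j) (hik : i ≠ k) (hjk : j ≠ k) :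
    Function.Injective ![i, j, k] := by
  intro a b; fin_cases a <;> fin_cases b <;> simp [hij, hik, hjk, hij.symm, hik.symm, hjk.symm]

section General
variable {ι : Type*} [DecidableEq ι] {f : (ι → ZMod 3) → Block}

theorem trichotomy (hf : Good f) (h0 : f 0 = Block.X) {i j : ι} (hij : i ≠ j) :
    Checkered f i j ∨ Dominates f i j ∨ Dominates f j i := by
  have he := injective_two hij
  have h := trichotomy_fin (hf.extendZero he) (extendZero_block_zero _ h0)
  rw [checkered_extendZero he, dominates_extendZero he, dominates_extendZero he] at h
  exact h

theorem not_cycle (hf : Good f) (h0 : f 0 = Block.X) {i j k : ι} (hij : i ≠ j) (hik : i ≠ k)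
    (hjk : j ≠ k) (h1 : Dominates f i j) (h2 : Dominates f j k) (h3 : Dominates f k i) : False := by
  have he := injective_three hij hik hjk
  have key := not_cycle_fin (hf.extendZero he) (extendZero_block_zero _ h0)
  simp only [dominates_extendZero he] at key
  exact key h1 h2 h3

theorem dom_sign_eq (hf : Good f) (h0 : f 0 = Block.X) {i j k : ι} (hij : i ≠ j) (hik : i ≠ k)
    (hjk : j ≠ k) {s t : ZMod 3} (hs : s ≠ 0) (ht : t ≠ 0) (h1 : Dom f s i j) (h2 : Dom f t i k)
    (h3 : Dominates f j k) : s = t := by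
  by_contra hst
  have he := injective_three hij hik hjk
  have key := not_signs_fin (hf.extendZero he) (extendZero_block_zero _ h0) hs ht hst
  simp only [dominates_extendZero he, dom_extendZero he] at key
  exact key h1 h2 h3

theorem not_alternating (hf : Good f) (h0 : f 0 = Block.X) {a b c d : ι} (hab : a ≠ b) (hac : a ≠ c)
    (had : a ≠ d) (hbc : b ≠ c) (hbd : b ≠ d) (hcd : c ≠ d) (h1 : Checkered f a b)
    (h2 : Checkered f c d) (h3 : ¬ Checkered f a c) (h4 : ¬ Checkered f b d) : False := by
  have he : Function.Injective ![a, b, c, d] := by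
    intro x y
    fin_cases x <;> fin_cases y <;>
      simp [hab, hac, had, hbc, hbd, hcd, hab.symm, hac.symm, had.symm, hbc.symm, hbd.symm, hcd.symm]
  have key := not_alternating_fin (hf.extendZero he) (extendZero_block_zero _ h0)
  simp only [dominates_extendZero he, checkered_extendZero he] at key
  exact key h1 h2 ((trichotomy hf h0 hac).resolve_left h3) ((trichotomy hf h0 hbd).resolve_left h4)
    (trichotomy hf h0 had) (trichotomy hf h0 hbc)

/-- Rescaling coordinates switches the signed graph of checkerboards, which allows the signs at one
vertex to be normalized. -/
theorem chk_smul {s : ZMod 3} {i j : ι} {σ : ι → ZMod 3} (hσ : ∀ i, σ i ≠ 0) (h : Chk f s i j) :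
    Chk (fun x => f (σ * x)) (s * σ i * σ j) i j := by
  intro a b ha hb
  have h1 : σ * (Pi.single i a + Pi.single j b : ι → ZMod 3) =
      Pi.single i (σ i * a) + Pi.single j (σ j * b) := by
    funext k
    simp only [Pi.mul_apply, Pi.add_apply, Pi.single_apply, mul_add]
    congr 1 <;> split_ifs with hk <;> simp [hk]
  have h2 := h (σ i * a) (σ j * b) (mul_ne_zero (hσ i) ha) (mul_ne_zero (hσ j) hb)
  change _ ∈ (f (σ * _)).toFinset
  rw [h1]
  convert h2 using 1
  ring

end General

/-! ### No six pairwise checkered coordinates -/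

theorem exists_sgn {s : ZMod 3} (hs : s ≠ 0) : ∃ b : Bool, s = (sgn b : ZMod 3) := by
  rcases ZMod.three_cases hs with rfl | rfl
  · exact ⟨true, rfl⟩
  · exact ⟨false, rfl⟩

theorem exists_signs {f : (Fin 6 → ZMod 3) → Block} (h : ∀ i j : Fin 6, i < j → Checkered f i j) :
    ∃ p : ℕ → ℕ → Bool, ∀ i j : Fin 6, i < j → Chk f (sgn (p i j)) i j := by
  have h1 : ∀ i j : ℕ, ∃ b : Bool, ∀ (hi : i < 6) (hj : j < 6), i < j →
      Chk f (sgn b) ⟨i, hi⟩ ⟨j, hj⟩ := by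
    intro i j
    by_cases hc : i < 6 ∧ j < 6 ∧ i < j
    · obtain ⟨s, hs, hS⟩ := h ⟨i, hc.1⟩ ⟨j, hc.2.1⟩ hc.2.2
      obtain ⟨b, rfl⟩ := exists_sgn hs
      exact ⟨b, fun _ _ _ => hS⟩
    · exact ⟨true, fun hi hj hij => (hc ⟨hi, hj, hij⟩).elim⟩
  choose p hp using h1
  exact ⟨p, fun i j hij => hp i j i.2 j.2 hij⟩

theorem not_hasEven {f : (Fin 6 → ZMod 3) → Block} (hf : Good f) (h0 : f 0 = Block.X)
    {p : ℕ → ℕ → Bool} (hp : ∀ i j : Fin 6, i < j → Chk f (sgn (p i j)) i j) :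
    hasEven p = false := by
  by_contra hc
  rw [Bool.not_eq_false, hasEven, List.any_eq_true] at hc
  obtain ⟨⟨i, j, k, l⟩, hq, he⟩ := hc
  have hlt : ∀ q ∈ quadruples, q.1 < q.2.1 ∧ q.2.1 < q.2.2.1 ∧ q.2.2.1 < q.2.2.2 ∧ q.2.2.2 < 6 := by
    decide
  obtain ⟨hij, hjk, hkl, hl⟩ := hlt _ hq
  dsimp only at hij hjk hkl hl he
  have hinj : Function.Injective (![⟨i, by omega⟩, ⟨j, by omega⟩, ⟨k, by omega⟩, ⟨l, hl⟩] :
      Fin 4 → Fin 6) := by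
    intro x y
    fin_cases x <;> fin_cases y <;> simp <;> omega
  have key := not_even_fin (hf.extendZero hinj) (extendZero_block_zero _ h0) he
  simp only [chk_extendZero hinj] at key
  exact key (hp ⟨i, _⟩ ⟨j, _⟩ (by simp; omega)) (hp ⟨i, _⟩ ⟨k, _⟩ (by simp; omega))
    (hp ⟨i, _⟩ ⟨l, _⟩ (by simp; omega)) (hp ⟨j, _⟩ ⟨k, _⟩ (by simp; omega))
    (hp ⟨j, _⟩ ⟨l, _⟩ (by simp; omega)) (hp ⟨k, _⟩ ⟨l, _⟩ (by simp; omega))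

theorem not_six_normalized {f : (Fin 6 → ZMod 3) → Block} (hf : Good f) (h0 : f 0 = Block.X)
    {p : ℕ → ℕ → Bool} (hp : ∀ i j : Fin 6, i < j → Chk f (sgn (p i j)) i j)
    (h5 : ∀ i < 5, p i 5 = true) : False := by
  set p' := edgeSign (p 0 1) (p 0 2) (p 0 3) (p 0 4) (p 1 2) (p 1 3) (p 1 4) (p 2 3) (p 2 4) (p 3 4)
    with hp'
  have hpp : ∀ i j : Fin 6, i < j → p' i j = p i j := by
    intro i j hij
    fin_cases i <;> fin_cases j <;> first
      | exact absurd hij (by decide)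
      | rfl
      | exact (h5 _ (by norm_num)).symm
  have hsym : ∀ i j : Fin 6, i ≠ j → Chk f (sgn (symSign p' i j)) i j := by
    intro i j hij
    rcases lt_or_gt_of_ne hij with h | h
    · have : symSign p' i j = p' i j := by
        rw [symSign, show Nat.blt i j = true by simpa [Nat.blt_eq] using h]; rfl
      rw [this, hpp i j h]
      exact hp i j h
    · have : symSign p' i j = p' j i := by
        rw [symSign, show Nat.blt i j = false by
          rw [Bool.eq_false_iff, ne_eq, Nat.blt_eq]; exact not_lt.mpr (le_of_lt h)]; rfl
      rw [this, hpp j i h]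
      exact (hp j i h).symm
  have hev := not_hasEven hf h0 (p := p') fun i j hij => by rw [hpp i j hij]; exact hp i j hij
  rcases exists_pentagon (p 0 1) (p 0 2) (p 0 3) (p 0 4) (p 1 2) (p 1 3) (p 1 4) (p 2 3) (p 2 4)
    (p 3 4) with h | ⟨a, ha, b, hb, c, hc, d, hd, h⟩
  · rw [← hp', hev] at h; cases h
  rw [← hp'] at h
  simp only [isPentagon, Bool.and_eq_true, decide_eq_true_eq, Bool.not_eq_true'] at h
  obtain ⟨⟨⟨⟨⟨⟨⟨⟨⟨⟨hnd, h0a⟩, hab⟩, hbc⟩, hcd⟩, h0d⟩, h0b⟩, hbd⟩, had⟩, hac⟩, h0c⟩ := h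
  have hnd' : 0 ≠ a ∧ 0 ≠ b ∧ 0 ≠ c ∧ 0 ≠ d ∧ a ≠ b ∧ a ≠ c ∧ a ≠ d ∧ b ≠ c ∧ b ≠ d ∧ c ≠ d := by
    simp at hnd; omega
  -- Relabel the first five coordinates in the cyclic order of the pentagon, so that the signs
  -- become `pentagonSign`.
  set e : Fin 6 → Fin 6 := ![0, ⟨a, by omega⟩, ⟨b, by omega⟩, ⟨c, by omega⟩, ⟨d, by omega⟩, 5]
    with he
  have hinj : Function.Injective e := by
    intro x y
    fin_cases x <;> fin_cases y <;> simp [he, Fin.ext_iff] <;> omega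
  have hs5 : ∀ x : ℕ, x < 5 → symSign p' x 5 = true := by
    intro x hx
    rw [symSign, show Nat.blt x 5 = true by simpa [Nat.blt_eq] using hx]
    interval_cases x <;> rfl
  refine not_pentagon_fin (hf.extendZero hinj) (extendZero_block_zero _ h0) fun i j hij => ?_
  rw [chk_extendZero hinj]
  have h1 := hsym (e i) (e j) fun h => hij.ne (hinj h)
  have h2 : symSign p' (e i) (e j) = pentagonSign i j := by
    fin_cases i <;> fin_cases j <;> first
      | exact absurd hij (by decide)
      | exact h0a
      | exact hab
      | exact hbc
      | exact hcd
      | exact h0d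
      | exact h0b
      | exact hbd
      | exact had
      | exact hac
      | exact h0c
      | exact hs5 0 (by norm_num)
      | exact hs5 a ha
      | exact hs5 b hb
      | exact hs5 c hc
      | exact hs5 d hd
  rwa [h2] at h1

theorem not_six_fin {f : (Fin 6 → ZMod 3) → Block} (hf : Good f) (h0 : f 0 = Block.X)
    (h : ∀ i j : Fin 6, i < j → Checkered f i j) : False := by
  obtain ⟨p, hp⟩ := exists_signs h
  -- This multiplies the sign of the pair `i, 5` by itself, making it `1`.
  set σ : Fin 6 → ZMod 3 := fun i => if i < 5 then sgn (p i 5) else 1 with hσ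
  have hne : ∀ b : Bool, (sgn b : ZMod 3) ≠ 0 := by decide
  have hσ0 : ∀ i, σ i ≠ 0 := fun i => by
    rw [hσ]; dsimp only; split_ifs
    · exact hne _
    · decide
  have hsq : ∀ b : Bool, (sgn b : ZMod 3) * sgn b * 1 = sgn true := by decide
  have hex : ∀ i j : ℕ, ∃ b : Bool, ∀ (hi : i < 6) (hj : j < 6),
      (sgn (p i j) : ZMod 3) * σ ⟨i, hi⟩ * σ ⟨j, hj⟩ = sgn b := by
    intro i j
    by_cases hc : i < 6 ∧ j < 6
    · obtain ⟨b, hb⟩ := exists_sgn (mul_ne_zero (mul_ne_zero (hne (p i j)) (hσ0 ⟨i, hc.1⟩))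
        (hσ0 ⟨j, hc.2⟩))
      exact ⟨b, fun _ _ => hb⟩
    · exact ⟨true, fun hi hj => (hc ⟨hi, hj⟩).elim⟩
  choose p' hp' using hex
  have hinj : ∀ b : Bool, (sgn b : ZMod 3) = sgn true → b = true := by decide
  refine not_six_normalized (hf.smul hσ0) (p := p') ?_ (fun i j hij => ?_) fun i hi => ?_
  · rw [mul_zero, h0]
  · rw [← hp' i j i.2 j.2]
    exact chk_smul hσ0 (hp i j hij)
  · refine hinj _ ?_
    rw [← hp' i 5 (by omega) (by norm_num), ← hsq (p i 5)]
    have h1 : σ ⟨i, by omega⟩ = sgn (p i 5) := if_pos (Fin.lt_def.mpr hi)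
    have h2 : σ ⟨5, by norm_num⟩ = 1 := if_neg (by decide)
    rw [h1, h2]

theorem not_six {ι : Type*} [DecidableEq ι] {f : (ι → ZMod 3) → Block} (hf : Good f)
    (h0 : f 0 = Block.X) {Q : Finset ι} (hQ : ∀ i ∈ Q, ∀ j ∈ Q, i ≠ j → Checkered f i j) :
    Q.card ≤ 5 := by
  by_contra hc
  obtain ⟨Q', hQ', hcard⟩ := Finset.exists_subset_card_eq (show 6 ≤ Q.card by omega)
  let e := (Q'.equivFinOfCardEq hcard).symm
  have he : Function.Injective fun k => (e k : ι) := Subtype.val_injective.comp e.injective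
  refine not_six_fin (hf.extendZero he) (extendZero_block_zero _ h0) fun i j hij => ?_
  rw [checkered_extendZero he]
  exact hQ _ (hQ' (e i).2) _ (hQ' (e j).2) fun h => hij.ne (he h)

/-! ### Graphs without alternating four-cycles -/

section Threshold
variable {V : Type*} [DecidableEq V] {K : V → V → Prop}

open Classical in
theorem exists_isolated_or_dominating (hsymm : ∀ a b, K a b → K b a)
    (hK : ∀ a b c d, a ≠ b → a ≠ c → a ≠ d → b ≠ c → b ≠ d → c ≠ d → K a b → K c d → ¬ K a c →
      ¬ K b d → False) {S : Finset V} (hS : S.Nonempty) :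
    ∃ v ∈ S, (∀ u ∈ S, u ≠ v → ¬ K v u) ∨ ∀ u ∈ S, u ≠ v → K v u := by
  -- Take `v` of maximal degree, a non-neighbour `w` of `v` and a neighbour `u` of `w`. Without
  -- alternating four-cycles, every neighbour of `v` other than `u` is a neighbour of `u`; as `u`
  -- also has the neighbour `w`, its degree exceeds that of `v`.
  let N (v : V) : Finset V := S.filter fun u => u ≠ v ∧ K v u
  have hN : ∀ {v u}, u ∈ N v ↔ u ∈ S ∧ u ≠ v ∧ K v u := by simp [N]
  obtain ⟨v, hv, hmax⟩ := S.exists_max_image (fun v => (N v).card) hS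
  by_contra hc
  push Not at hc
  obtain ⟨-, w, hw, hwv, hvw⟩ := hc v hv
  obtain ⟨⟨u, hu, huw, hwu⟩, -⟩ := hc w hw
  have huv : u ≠ v := by rintro rfl; exact hvw (hsymm _ _ hwu)
  have hsub : ∀ x ∈ N v, x ≠ u → x ∈ N u := by
    intro x hx hxu
    obtain ⟨hxS, hxv, hvx⟩ := hN.mp hx
    refine hN.mpr ⟨hxS, hxu, ?_⟩
    by_contra hux
    have hxw : x ≠ w := by rintro rfl; exact hvw hvx
    exact hK w u v x huw.symm hwv hxw.symm huv hxu.symm hxv.symm hwu hvx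
      (fun h => hvw (hsymm _ _ h)) hux
  have hwN : w ∈ N u := hN.mpr ⟨hw, huw.symm, hsymm _ _ hwu⟩
  have hwN' : w ∉ N v := fun h => hvw (hN.mp h).2.2
  have hle : (N u).card ≤ (N v).card := hmax u hu
  by_cases huN : u ∈ N v
  · have hvN : v ∈ N u := hN.mpr ⟨hv, huv.symm, hsymm _ _ (hN.mp huN).2.2⟩
    have hss : insert w ((N v).erase u) ⊆ (N u).erase v := by
      intro x hx
      rcases Finset.mem_insert.mp hx with rfl | hx
      · exact Finset.mem_erase.mpr ⟨hwv, hwN⟩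
      · obtain ⟨hxu, hx⟩ := Finset.mem_erase.mp hx
        exact Finset.mem_erase.mpr ⟨(hN.mp hx).2.1, hsub x hx hxu⟩
    have hcard := Finset.card_le_card hss
    rw [Finset.card_insert_of_notMem (fun h => hwN' (Finset.mem_of_mem_erase h)),
      Finset.card_erase_of_mem huN, Finset.card_erase_of_mem hvN] at hcard
    have h1 : 0 < (N v).card := Finset.card_pos.mpr ⟨u, huN⟩
    have h2 : 0 < (N u).card := Finset.card_pos.mpr ⟨v, hvN⟩
    omega
  · have hss : N v ⊂ N u := by
      refine (Finset.ssubset_iff_of_subset fun x hx => hsub x hx ?_).mpr ⟨w, hwN, hwN'⟩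
      rintro rfl; exact huN hx
    exact absurd (Finset.card_lt_card hss) (not_lt.mpr hle)

/-- A graph without alternating four-cycles has a clique and an independent set that together have
more elements than there are vertices. -/
theorem exists_clique_indep (hsymm : ∀ a b, K a b → K b a)
    (hK : ∀ a b c d, a ≠ b → a ≠ c → a ≠ d → b ≠ c → b ≠ d → c ≠ d → K a b → K c d → ¬ K a c →
      ¬ K b d → False) (S : Finset V) (hS : S.Nonempty) :
    ∃ Q I : Finset V, Q ⊆ S ∧ I ⊆ S ∧ (∀ i ∈ Q, ∀ j ∈ Q, i ≠ j → K i j) ∧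
      (∀ i ∈ I, ∀ j ∈ I, i ≠ j → ¬ K i j) ∧ S.card + 1 ≤ Q.card + I.card := by
  induction S using Finset.strongInduction with
  | H S ih =>
  obtain ⟨v, hv, h⟩ := exists_isolated_or_dominating hsymm hK hS
  have hcard := Finset.card_erase_add_one hv
  rcases (S.erase v).eq_empty_or_nonempty with he | hne
  -- The last vertex counts both as a clique and as an independent set, hence the additional `1`.
  · refine ⟨{v}, {v}, by simpa using hv, by simpa using hv, ?_, ?_, ?_⟩
    · intro i hi j hj hij
      exact absurd ((Finset.mem_singleton.mp hi).trans (Finset.mem_singleton.mp hj).symm) hij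
    · intro i hi j hj hij
      exact absurd ((Finset.mem_singleton.mp hi).trans (Finset.mem_singleton.mp hj).symm) hij
    · rw [he] at hcard
      simp at hcard ⊢
      omega
  · obtain ⟨Q, I, hQ, hI, hQK, hIK, hle⟩ := ih _ (Finset.erase_ssubset hv) hne
    have hvQ : v ∉ Q := fun h => Finset.notMem_erase v S (hQ h)
    have hvI : v ∉ I := fun h => Finset.notMem_erase v S (hI h)
    have hsub := Finset.erase_subset v S
    rcases h with h | h
    · refine ⟨Q, insert v I, hQ.trans hsub, Finset.insert_subset hv (hI.trans hsub), hQK, ?_, ?_⟩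
      · intro i hi j hj hij
        rcases Finset.mem_insert.mp hi with rfl | hi'
        · rcases Finset.mem_insert.mp hj with rfl | hj'
          · exact absurd rfl hij
          · exact h j (hsub (hI hj')) hij.symm
        · rcases Finset.mem_insert.mp hj with rfl | hj'
          · exact fun hK => h i (hsub (hI hi')) hij (hsymm _ _ hK)
          · exact hIK i hi' j hj' hij
      · rw [Finset.card_insert_of_notMem hvI]; omega
    · refine ⟨insert v Q, I, Finset.insert_subset hv (hQ.trans hsub), hI.trans hsub, ?_, hIK, ?_⟩
      · intro i hi j hj hij
        rcases Finset.mem_insert.mp hi with rfl | hi'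
        · rcases Finset.mem_insert.mp hj with rfl | hj'
          · exact absurd rfl hij
          · exact h j (hsub (hQ hj')) hij.symm
        · rcases Finset.mem_insert.mp hj with rfl | hj'
          · exact hsymm _ _ (h i (hsub (hQ hi')) hij)
          · exact hQK i hi' j hj' hij
      · rw [Finset.card_insert_of_notMem hvQ]; omega

end Threshold

/-! ### The domination tournament on an independent set -/

section Signs
variable {ι : Type*} [DecidableEq ι] {f : (ι → ZMod 3) → Block}

theorem exists_indep_of_good [Fintype ι] [Nonempty ι] (hf : Good f) (h0 : f 0 = Block.X) :
    ∃ I : Finset ι, Fintype.card ι - 4 ≤ I.card ∧ ∀ i ∈ I, ∀ j ∈ I, i ≠ j → ¬ Checkered f i j := by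
  obtain ⟨Q, I, -, -, hQ, hI, hle⟩ := exists_clique_indep (K := Checkered f)
    (fun _ _ h => h.symm) (fun _ _ _ _ h1 h2 h3 h4 h5 h6 => not_alternating hf h0 h1 h2 h3 h4 h5 h6)
    Finset.univ Finset.univ_nonempty
  have := not_six hf h0 hQ
  rw [Finset.card_univ] at hle
  exact ⟨I, by omega, hI⟩

/-- Of two coordinates dominated by `i`, one dominates the other, so `dom_sign_eq` applies in one of
the two orders. If `i` dominates nothing, the sign is arbitrary. -/
theorem exists_dom_sign (hf : Good f) (h0 : f 0 = Block.X) {I : Finset ι}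
    (hI : ∀ i ∈ I, ∀ j ∈ I, i ≠ j → ¬ Checkered f i j) :
    ∃ ε : ι → ZMod 3, (∀ i, ε i ≠ 0) ∧
      ∀ i ∈ I, ∀ j ∈ I, i ≠ j → Dominates f i j → Dom f (ε i) i j := by
  have h : ∀ i, ∃ s : ZMod 3, s ≠ 0 ∧
      (i ∈ I → ∀ j ∈ I, i ≠ j → Dominates f i j → Dom f s i j) := by
    intro i
    by_cases hc : ∃ k ∈ I, i ≠ k ∧ Dominates f i k
    · obtain ⟨k, hk, hik, s, hs, hS⟩ := hc
      refine ⟨s, hs, fun hi j hj hij ⟨t, ht, hT⟩ => ?_⟩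
      by_cases hjk : j = k
      · rw [hjk]; exact hS
      · rcases (trichotomy hf h0 hjk).resolve_left (hI j hj k hk hjk) with h | h
        · rw [dom_sign_eq hf h0 hij hik hjk ht hs hT hS h] at hT
          exact hT
        · rw [← dom_sign_eq hf h0 hik hij (Ne.symm hjk) hs ht hS hT h] at hT
          exact hT
    · exact ⟨1, by decide, fun _ j hj hij hd => (hc ⟨j, hj, hij, hd⟩).elim⟩
  choose ε h1 h2 using h
  exact ⟨ε, h1, h2⟩

theorem exists_sink (hf : Good f) (h0 : f 0 = Block.X) {I : Finset ι}
    (hI : ∀ i ∈ I, ∀ j ∈ I, i ≠ j → ¬ Checkered f i j) (S : Finset ι) (hS : S.Nonempty)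
    (hSI : S ⊆ I) : ∃ l ∈ S, ∀ i ∈ S, i ≠ l → Dominates f i l := by
  induction hS using Finset.Nonempty.cons_induction with
  | singleton a =>
    exact ⟨a, by simp, fun i hi hia => absurd (Finset.mem_singleton.mp hi) hia⟩
  | cons a S haS hS ih =>
    have ha : a ∈ I := hSI (Finset.mem_cons_self a S)
    have hSI' : S ⊆ I := fun x hx => hSI (Finset.mem_cons_of_mem hx)
    obtain ⟨l, hl, hsink⟩ := ih hSI'
    have hal : a ≠ l := fun h => haS (h ▸ hl)
    rcases (trichotomy hf h0 hal).resolve_left (hI a ha l (hSI' hl) hal) with h | h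
    · refine ⟨l, Finset.mem_cons_of_mem hl, fun i hi hil => ?_⟩
      rcases Finset.mem_cons.mp hi with rfl | hi
      · exact h
      · exact hsink i hi hil
    · refine ⟨a, Finset.mem_cons_self a S, fun i hi hia => ?_⟩
      have hiS := (Finset.mem_cons.mp hi).resolve_left hia
      by_cases hil : i = l
      -- When `a` dominates the old sink `l`, that sink stays; here `l` dominates `a`, and `a` is
      -- the new sink, since an `i` dominated by `a` would close a three-cycle with `l`.
      · rw [hil]; exact h
      · refine ((trichotomy hf h0 hia).resolve_left (hI i (hSI' hiS) a ha hia)).resolve_right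
          fun hc => ?_
        exact not_cycle hf h0 hil hia hal.symm (hsink i hiS hil) h hc

end Signs

/-! ### The values of `f` on an independent set -/

section Structure
variable {ι : Type*} [DecidableEq ι] {f : (ι → ZMod 3) → Block}

omit [DecidableEq ι] in
theorem Good.eq_of_mem (hf : Good f) {x y z : ι → ZMod 3} {c : ZMod 3} (hx : c ∈ (f x).toFinset)
    (hy : c ∈ (f y).toFinset) (hz : c ∈ (f z).toFinset) (hxy : LineAdj x y) (hxz : LineAdj x z) :
    y = z := by
  let P (x : ι → ZMod 3) : Option ι → ZMod 3 := fun o => o.elim c x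
  have hP : ∀ {x y}, LineAdj x y → LineAdj (P x) (P y) := by
    rintro x y ⟨hne, i, hi⟩
    refine ⟨fun h => hne (funext fun j => congrFun h (some j)), some i, fun o ho => ?_⟩
    rcases o with _ | j
    · rfl
    · exact hi j fun h => ho (by rw [h])
  have h := hf (P x) hx (P y) hy (P z) hz (hP hxy) (hP hxz)
  exact funext fun j => congrFun h (some j)

-- Two points over the same `x` are each other's only neighbours.
omit [DecidableEq ι] in
theorem Good.notMem_of_two (hf : Good f) {x y : ι → ZMod 3} {c c' : ZMod 3} (hcc : c ≠ c')
    (hx : c ∈ (f x).toFinset) (hx' : c' ∈ (f x).toFinset) (hxy : LineAdj x y) :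
    c ∉ (f y).toFinset := by
  intro hy
  let P (c : ZMod 3) (x : ι → ZMod 3) : Option ι → ZMod 3 := fun o => o.elim c x
  obtain ⟨hne, i, hi⟩ := hxy
  have h := hf (P c x) hx (P c' x) hx' (P c y) hy
    ⟨fun h => hcc (congrFun h none), none, fun o ho => by
      rcases o with _ | j
      · exact absurd rfl ho
      · rfl⟩
    ⟨fun h => hne (funext fun j => congrFun h (some j)), some i, fun o ho => by
      rcases o with _ | j
      · rfl
      · exact hi j fun h => ho (by rw [h])⟩
  exact hcc (congrFun h none).symm

theorem lineAdj_update {y : ι → ZMod 3} {i : ι} {t : ZMod 3} (h : t ≠ y i) :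
    LineAdj y (Function.update y i t) :=
  ⟨fun h0 => h (by rw [h0, Function.update_self]), i, fun j hj => by
    rw [Function.update_of_ne hj]⟩

theorem Block.exists_mem (b : Block) : ∃ c, c ∈ b.toFinset := by
  cases b <;> decide

theorem ZMod.eq_of_three {a b c : ZMod 3} (ha : a ≠ 0) (hb : b ≠ 0) (hab : a ≠ b) {t : ZMod 3}
    (h1 : c ≠ t - a) (h2 : c ≠ t - b) : c = t := by
  revert a b c t; decide

/-- Two points with the same support, in the form used below: `y i ≠ 0` exactly for `i ∈ S`. -/
def HasSupport (y : ι → ZMod 3) (S : Finset ι) : Prop := ∀ i, y i ≠ 0 ↔ i ∈ S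

theorem HasSupport.update {y : ι → ZMod 3} {S : Finset ι} (h : HasSupport y S) {k : ι} (hk : k ∈ S)
    {t : ZMod 3} (ht : t ≠ 0) : HasSupport (Function.update y k t) S := fun i => by
  by_cases hik : i = k
  · rw [hik, Function.update_self]; exact iff_of_true ht hk
  · rw [Function.update_of_ne hik]; exact h i

theorem HasSupport.update_zero {y : ι → ZMod 3} {S : Finset ι} (h : HasSupport y S) (k : ι) :
    HasSupport (Function.update y k 0) (S.erase k) := fun i => by
  by_cases hik : i = k
  · rw [hik, Function.update_self]; simp
  · rw [Function.update_of_ne hik, h i]; simp [hik]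

variable {I : Finset ι} {ε : ι → ZMod 3}

theorem sum_update (y : ι → ZMod 3) {k : ι} (hk : k ∈ I) (t : ZMod 3) :
    ∑ i ∈ I, ε i * Function.update y k t i = ∑ i ∈ I, ε i * y i - ε k * y k + ε k * t := by
  rw [← Finset.add_sum_erase I _ hk, ← Finset.add_sum_erase I (fun i => ε i * y i) hk,
    Function.update_self]
  have : ∑ i ∈ I.erase k, ε i * Function.update y k t i = ∑ i ∈ I.erase k, ε i * y i :=
    Finset.sum_congr rfl fun i hi => by rw [Function.update_of_ne (Finset.ne_of_mem_erase hi)]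
  rw [this]; ring

theorem neg_ne_self_of_ne_zero {a : ZMod 3} (h : a ≠ 0) : -a ≠ a := by
  revert a; decide

theorem mem_iff_of_unique {b : Block} {t : ZMod 3} (h : ∀ c ∈ b.toFinset, c = t) (c : ZMod 3) :
    c ∈ b.toFinset ↔ c = t := by
  refine ⟨h c, ?_⟩
  rintro rfl
  obtain ⟨d, hd⟩ := b.exists_mem
  rwa [h d hd] at hd

omit [DecidableEq ι] in
theorem mem_iff_single (hf : Good f) (h0 : f 0 = Block.X) {l : ι} {y : ι → ZMod 3}
    (hy : HasSupport y {l}) (c : ZMod 3) : c ∈ (f y).toFinset ↔ c = 0 := by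
  refine mem_iff_of_unique (fun c hc => ?_) c
  have hy0 : ∀ i, i ≠ l → y i = 0 := fun i hi => by
    by_contra h; exact hi (Finset.mem_singleton.mp ((hy i).mp h))
  have hadj : LineAdj 0 y := ⟨fun h => (hy l).mpr (by simp) (by rw [← h]; rfl), l, fun j hj => by
    rw [hy0 j hj]; rfl⟩
  have h1 : (1 : ZMod 3) ∈ (f 0).toFinset := by rw [h0]; decide
  have h2 : (2 : ZMod 3) ∈ (f 0).toFinset := by rw [h0]; decide
  have h3 := hf.notMem_of_two (by decide) h1 h2 hadj
  have h4 := hf.notMem_of_two (by decide) h2 h1 hadj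
  have h5 : ∀ c : ZMod 3, c = 0 ∨ c = 1 ∨ c = 2 := by decide
  rcases h5 c with rfl | rfl | rfl
  · rfl
  · exact absurd hc h3
  · exact absurd hc h4

/-- Changing the sign of `y l` keeps the value `s * y i`, so the point with this value has its one
neighbour there and no second value fits at `y`. -/
theorem mem_iff_pair (hf : Good f) {i l : ι} (hil : i ≠ l) {s : ZMod 3} (hd : Dom f s i l)
    {y : ι → ZMod 3} (hy : HasSupport y {i, l}) (c : ZMod 3) :
    c ∈ (f y).toFinset ↔ c = s * y i := by
  have hval : ∀ y : ι → ZMod 3, HasSupport y {i, l} → s * y i ∈ (f y).toFinset := by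
    intro y hy
    have h := hd (y i) (y l) ((hy i).mpr (by simp)) ((hy l).mpr (by simp))
    have he : Pi.single i (y i) + Pi.single l (y l) = y := by
      funext j
      by_cases hji : j = i
      · rw [hji]; simp [hil]
      · by_cases hjl : j = l
        · rw [hjl]; simp [hil.symm]
        · have : y j = 0 := by
            by_contra h
            have := (hy j).mp h
            simp [hji, hjl] at this
          simp [hji, hjl, this]
    rwa [he] at h
  have hyi : y i ≠ 0 := (hy i).mpr (by simp)
  have hyl : y l ≠ 0 := (hy l).mpr (by simp)
  refine mem_iff_of_unique (fun c hc => ?_) c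
  by_contra hne
  have hy' : HasSupport (Function.update y l (-y l)) {i, l} :=
    hy.update (by simp) (neg_ne_zero.mpr hyl)
  have h1 := hval _ hy'
  rw [Function.update_of_ne hil] at h1
  exact hf.notMem_of_two (Ne.symm hne) (hval y hy) hc
    (lineAdj_update (neg_ne_self_of_ne_zero hyl)) h1

/-- The value at a point with at least one nonzero coordinate. -/
theorem mem_iff_sum (hf : Good f) (h0 : f 0 = Block.X) (hε : ∀ i, ε i ≠ 0)
    (hD : ∀ i ∈ I, ∀ j ∈ I, i ≠ j → Dominates f i j → Dom f (ε i) i j) (S : Finset ι) (hSI : S ⊆ I)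
    {l : ι} (hl : l ∈ S) (hsink : ∀ i ∈ S, i ≠ l → Dominates f i l) {y : ι → ZMod 3}
    (hy : HasSupport y S) (c : ZMod 3) :
    c ∈ (f y).toFinset ↔ c = ∑ i ∈ I, ε i * y i - ε l * y l := by
  induction S using Finset.strongInduction generalizing y c with
  | H S ih =>
  have hsum : ∀ {y : ι → ZMod 3}, HasSupport y S →
      ∑ i ∈ I, ε i * y i = ∑ i ∈ S, ε i * y i := fun {y} hy =>
    (Finset.sum_subset hSI fun i _ hi => by
      have : y i = 0 := by by_contra h; exact hi ((hy i).mp h)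
      rw [this, mul_zero]).symm
  have hne : ∀ {y : ι → ZMod 3}, HasSupport y S → ∀ k ∈ S, ε k * y k ≠ 0 := fun hy k hk =>
    mul_ne_zero (hε k) ((hy k).mpr hk)
  rcases Nat.lt_or_ge S.card 3 with hcard | hcard
  · obtain ⟨R, hlR, rfl⟩ : ∃ R, l ∉ R ∧ S = insert l R :=
      ⟨S.erase l, Finset.notMem_erase l S, (Finset.insert_erase hl).symm⟩
    rw [Finset.card_insert_of_notMem hlR] at hcard
    rcases Nat.lt_or_ge R.card 1 with hR | hR
    · have hR0 : R = ∅ := Finset.card_eq_zero.mp (by omega)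
      subst hR0
      rw [hsum hy]
      simpa using mem_iff_single hf h0 (by simpa using hy) c
    · obtain ⟨i, rfl⟩ := Finset.card_eq_one.mp (show R.card = 1 by omega)
      have hil : i ≠ l := fun h => hlR (by simp [h])
      have hiS : i ∈ insert l ({i} : Finset ι) := by simp
      have hd := hD i (hSI hiS) l (hSI hl) hil (hsink i hiS hil)
      rw [hsum hy, Finset.sum_pair hil.symm, add_sub_cancel_left]
      exact mem_iff_pair hf hil hd (by rwa [Finset.pair_comm] at hy) c
  -- Write `t` for the claimed value. Setting `y k` to zero gives the value `t - ε k * y k` by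
  -- induction, also after negating `y l`. These two points are adjacent, so that value is excluded
  -- at `y`.
  have hex : ∀ {y : ι → ZMod 3}, HasSupport y S → ∀ k ∈ S, k ≠ l →
      ∑ i ∈ I, ε i * y i - ε l * y l - ε k * y k ∉ (f y).toFinset := by
    intro y hy k hk hkl hmem
    have hlk : l ∈ S.erase k := Finset.mem_erase.mpr ⟨hkl.symm, hl⟩
    have hyl : y l ≠ 0 := (hy l).mpr hl
    have hyk : y k ≠ 0 := (hy k).mpr hk
    have hS0 := hy.update_zero k
    have hS1 := hS0.update hlk (neg_ne_zero.mpr hyl)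
    have hI := fun {z : ι → ZMod 3} (hz : HasSupport z (S.erase k)) (c : ZMod 3) =>
      ih (S.erase k) (Finset.erase_ssubset hk) ((Finset.erase_subset k S).trans hSI) hlk
        (fun i hi => hsink i (Finset.mem_of_mem_erase hi)) hz c
    have e0 := (hI hS0 (∑ i ∈ I, ε i * y i - ε l * y l - ε k * y k)).mpr (by
      rw [sum_update y (hSI hk), Function.update_of_ne hkl.symm]; ring)
    have e1 := (hI hS1 (∑ i ∈ I, ε i * y i - ε l * y l - ε k * y k)).mpr (by
      rw [sum_update _ (hSI hl), sum_update y (hSI hk), Function.update_self,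
        Function.update_of_ne hkl.symm]; ring)
    have heq := hf.eq_of_mem e0 hmem e1 (lineAdj_update hyk.symm).symm
      (lineAdj_update (by rw [Function.update_of_ne hkl.symm]; exact neg_ne_self_of_ne_zero hyl))
    have := congrFun heq k
    rw [Function.update_of_ne hkl, Function.update_self] at this
    exact hyk this
  -- Two different nonzero terms exclude two values and leave only `t`.
  have hmixed : ∀ {y : ι → ZMod 3}, HasSupport y S → ∀ k ∈ S, k ≠ l → ∀ m ∈ S, m ≠ l →
      ε k * y k ≠ ε m * y m → ∀ c, c ∈ (f y).toFinset ↔ c = ∑ i ∈ I, ε i * y i - ε l * y l := by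
    intro y hy k hk hkl m hm hml hkm c
    refine mem_iff_of_unique (fun c hc => ?_) c
    exact ZMod.eq_of_three (hne hy k hk) (hne hy m hm) hkm
      (fun h => hex hy k hk hkl (h ▸ hc)) fun h => hex hy m hm hml (h ▸ hc)
  have hcard' : 1 < (S.erase l).card := by rw [Finset.card_erase_of_mem hl]; omega
  obtain ⟨k, hk, m, hm, hkm⟩ := Finset.one_lt_card.mp hcard'
  obtain ⟨hkl, hk⟩ := Finset.mem_erase.mp hk
  obtain ⟨hml, hm⟩ := Finset.mem_erase.mp hm
  by_cases hval : ε k * y k = ε m * y m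
  swap
  · exact hmixed hy k hk hkl m hm hml hval c
  have hyk : y k ≠ 0 := (hy k).mpr hk
  have hyl : y l ≠ 0 := (hy l).mpr hl
  -- If the two terms agree, negating `y k` makes them differ. The new value is `t - 2 * ε k * y k =
  -- t + ε k * y k`, and it persists when `y l` is negated too. This adjacent pair excludes `t + ε k
  -- * y k` at `y`; `hex` excludes `t - ε k * y k`.
  have hy1 : HasSupport (Function.update y k (-y k)) S := hy.update hk (neg_ne_zero.mpr hyk)
  have hy2 := hy1.update hl (neg_ne_zero.mpr hyl)
  have hthree : (3 : ZMod 3) = 0 := rfl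
  have hmix1 : ε k * Function.update y k (-y k) k ≠ ε m * Function.update y k (-y k) m := by
    rw [Function.update_self, Function.update_of_ne hkm.symm, ← hval, mul_neg]
    exact neg_ne_self_of_ne_zero (hne hy k hk)
  have hmix2 : ε k * Function.update (Function.update y k (-y k)) l (-y l) k ≠
      ε m * Function.update (Function.update y k (-y k)) l (-y l) m := by
    rw [Function.update_of_ne hkl, Function.update_of_ne hml]
    exact hmix1
  have e1 := (hmixed hy1 k hk hkl m hm hml hmix1
    (∑ i ∈ I, ε i * y i - ε l * y l + ε k * y k)).mpr (by
      rw [sum_update y (hSI hk), Function.update_of_ne hkl.symm]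
      linear_combination (ε k * y k) * hthree)
  have e2 := (hmixed hy2 k hk hkl m hm hml hmix2
    (∑ i ∈ I, ε i * y i - ε l * y l + ε k * y k)).mpr (by
      rw [sum_update _ (hSI hl), sum_update y (hSI hk), Function.update_self,
        Function.update_of_ne hkl.symm]
      linear_combination (ε k * y k) * hthree)
  have hnot : ∑ i ∈ I, ε i * y i - ε l * y l + ε k * y k ∉ (f y).toFinset := by
    intro hmem
    have heq := hf.eq_of_mem e1 hmem e2 (lineAdj_update (neg_ne_self_of_ne_zero hyk)).symm
      (lineAdj_update (by rw [Function.update_of_ne hkl.symm]; exact neg_ne_self_of_ne_zero hyl))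
    have := congrFun heq l
    rw [Function.update_self] at this
    exact neg_ne_self_of_ne_zero hyl this.symm
  refine mem_iff_of_unique (fun c hc => ?_) c
  refine ZMod.eq_of_three (hne hy k hk) (neg_ne_zero.mpr (hne hy k hk))
    (neg_ne_self_of_ne_zero (hne hy k hk)).symm (fun h => hex hy k hk hkl (h ▸ hc)) fun h => ?_
  rw [sub_neg_eq_add] at h
  exact hnot (h ▸ hc)

theorem sum_notMem (hf : Good f) (h0 : f 0 = Block.X) (hε : ∀ i, ε i ≠ 0)
    (hI : ∀ i ∈ I, ∀ j ∈ I, i ≠ j → ¬ Checkered f i j)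
    (hD : ∀ i ∈ I, ∀ j ∈ I, i ≠ j → Dominates f i j → Dom f (ε i) i j) {y : ι → ZMod 3}
    (hy : ∀ i, y i ≠ 0 → i ∈ I) : ∑ i ∈ I, ε i * y i ∉ (f y).toFinset := by
  have hS : HasSupport y (I.filter fun i => y i ≠ 0) := fun i => by
    simpa using hy i
  rcases (I.filter fun i => y i ≠ 0).eq_empty_or_nonempty with he | hne
  · have hy0 : y = 0 := funext fun i => by
      by_contra h
      have := (hS i).mp h
      rw [he] at this
      simp at this
    rw [hy0, h0]
    simp; decide
  · obtain ⟨l, hl, hsink⟩ := exists_sink hf h0 hI _ hne (Finset.filter_subset _ I)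
    intro hmem
    rw [mem_iff_sum hf h0 hε hD _ (Finset.filter_subset _ I) hl hsink hS] at hmem
    exact mul_ne_zero (hε l) ((hS l).mpr hl) (by linear_combination hmem)

end Structure

/-! ### Linear forms and canonical functions -/

section Canonical
variable {ι : Type*} [Fintype ι] [DecidableEq ι]

theorem LineAdj.sum_ne {x y : ι → ZMod 3} (h : LineAdj x y) {ε : ι → ZMod 3} (hε : ∀ i, ε i ≠ 0) :
    ∑ i, ε i * x i ≠ ∑ i, ε i * y i := by
  obtain ⟨hne, i, hi⟩ := h
  intro hsum
  have hrest : ∑ j ∈ Finset.univ.erase i, ε j * x j = ∑ j ∈ Finset.univ.erase i, ε j * y j :=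
    Finset.sum_congr rfl fun j hj => by rw [hi j (Finset.ne_of_mem_erase hj)]
  rw [← Finset.add_sum_erase _ _ (Finset.mem_univ i), ← Finset.add_sum_erase _ (fun i => ε i * y i)
    (Finset.mem_univ i), hrest] at hsum
  have := mul_left_cancel₀ (hε i) (add_right_cancel hsum)
  refine hne (funext fun j => ?_)
  by_cases hj : j = i
  · rw [hj, this]
  · exact hi j hj

/-- The independent set on which the additional coordinate is a given linear form in the others. -/
def linearIndepSet (ε : ι → ZMod 3) : Finset (Option ι → ZMod 3) :=
  Finset.univ.filter fun p => p none = ∑ i, ε i * p (some i)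

theorem linearIndepSet_isIndepSet {ε : ι → ZMod 3} (hε : ∀ i, ε i ≠ 0) :
    (hammingGraph (Option ι)).IsIndepSet (linearIndepSet ε : Set (Option ι → ZMod 3)) := by
  intro p hp q hq _ hadj
  have hp : p none = ∑ i, ε i * p (some i) := by simpa [linearIndepSet] using hp
  have hq : q none = ∑ i, ε i * q (some i) := by simpa [linearIndepSet] using hq
  obtain ⟨hne, o, ho⟩ := (hammingDist_eq_one_iff p q).mp hadj
  rcases o with _ | i
  · have hrest : ∀ i, p (some i) = q (some i) := fun i => ho (some i) (by simp)
    refine hne (funext fun o => ?_)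
    rcases o with _ | i
    · rw [hp, hq]; simp [hrest]
    · exact hrest i
  · have hnone := ho none (by simp)
    have hadj' : LineAdj (fun i => p (some i)) fun i => q (some i) := by
      refine ⟨fun h => hne (funext fun o => ?_), i, fun j hj => ho (some j) (by simpa using hj)⟩
      rcases o with _ | j
      · exact hnone
      · exact congrFun h j
    exact hadj'.sum_ne hε (hp.symm.trans (hnone.trans hq))

/-- An independent set contains at most one point of each line in the additional direction. -/
theorem card_le_of_isIndepSet (T : Finset (Option ι → ZMod 3))
    (hT : (hammingGraph (Option ι)).IsIndepSet (T : Set (Option ι → ZMod 3))) :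
    T.card ≤ Fintype.card (ι → ZMod 3) := by
  rw [← Finset.card_univ]
  refine Finset.card_le_card_of_injOn (fun p i => p (some i))
    (fun _ _ => Finset.mem_coe.mpr (Finset.mem_univ _)) ?_
  intro p hp q hq hpq
  by_contra hne
  refine hT hp hq hne ((hammingDist_eq_one_iff p q).mpr ⟨hne, none, fun o ho => ?_⟩)
  rcases o with _ | i
  · exact absurd rfl ho
  · exact congrFun hpq i

theorem card_le_card_linearIndepSet (ε : ι → ZMod 3) :
    Fintype.card (ι → ZMod 3) ≤ (linearIndepSet ε).card := by
  rw [← Finset.card_univ]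
  refine Finset.card_le_card_of_injOn (fun y o => o.elim (∑ i, ε i * y i) y) ?_ ?_
  · intro y _
    simp [linearIndepSet]
  · intro y _ z _ h
    exact funext fun i => congrFun h (some i)

theorem linearIndepSet_isMaximumIndepSet {ε : ι → ZMod 3} (hε : ∀ i, ε i ≠ 0) :
    (hammingGraph (Option ι)).IsMaximumIndepSet (linearIndepSet ε) :=
  ⟨linearIndepSet_isIndepSet hε, fun T hT =>
    (card_le_of_isIndepSet T hT).trans (card_le_card_linearIndepSet ε)⟩

theorem le_card_correspondingSet {g : (ι → ZMod 3) → Block} (h0 : g 0 = Block.X) :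
    3 ^ Fintype.card ι + 1 ≤ (correspondingSet g).card := by
  let F : (ι → ZMod 3) → Finset (Option ι → ZMod 3) := fun y =>
    (correspondingSet g).filter fun p => (fun i => p (some i)) = y
  have hF : ∀ y, ∀ c ∈ (g y).toFinset, (fun o : Option ι => o.elim c y) ∈ F y := fun y c hc => by
    simpa [F, correspondingSet] using hc
  have hsum : (correspondingSet g).card = ∑ y, (F y).card :=
    Finset.card_eq_sum_card_fiberwise fun _ _ => Finset.mem_coe.mpr (Finset.mem_univ _)
  have hlt : ∑ _y : ι → ZMod 3, 1 < ∑ y, (F y).card := by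
    refine Finset.sum_lt_sum (fun y _ => ?_) ⟨0, Finset.mem_univ _, ?_⟩
    · obtain ⟨c, hc⟩ := (g y).exists_mem
      exact Finset.card_pos.mpr ⟨_, hF y c hc⟩
    · refine Finset.one_lt_card.mpr ⟨_, hF 0 1 (by rw [h0]; decide), _,
        hF 0 2 (by rw [h0]; decide), fun h => ?_⟩
      exact absurd (congrFun h none) (by decide : (1 : ZMod 3) ≠ 2)
  rw [hsum]
  simpa [ZMod.card] using hlt

/-- A function of low degree with `g 0 = X` whose values avoid a linear form with nonzero
coefficients is canonical. -/
theorem isCanonicalFunction_of_sum_notMem {g : (ι → ZMod 3) → Block} (hg : Good g)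
    (h0 : g 0 = Block.X) {ε : ι → ZMod 3} (hε : ∀ i, ε i ≠ 0)
    (h : ∀ y, ∑ i, ε i * y i ∉ (g y).toFinset) : IsCanonicalFunction g := by
  refine ⟨?_, ⟨linearIndepSet ε, linearIndepSet_isMaximumIndepSet hε, ?_⟩,
    (functionInducedDegree_le_one_iff g).mpr hg⟩
  · rw [Fintype.card_option, Nat.add_sub_cancel]
    exact le_card_correspondingSet h0
  · refine Finset.disjoint_left.mpr fun p hp hq => h (fun i => p (some i)) ?_
    have hp : p none ∈ (g fun i => p (some i)).toFinset := by simpa [correspondingSet] using hp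
    have hq : p none = ∑ i, ε i * p (some i) := by simpa [linearIndepSet] using hq
    rwa [← hq]

end Canonical

/-! ### Conclusion -/

theorem restrictToCoords_eq {ι : Type*} [DecidableEq ι] (f : (ι → ZMod 3) → Block) (I : Finset ι) :
    restrictToCoords f I = f ∘ extendZero (Subtype.val : I → ι) := by
  funext y
  refine congrArg f (funext fun i => ?_)
  by_cases h : i ∈ I
  · rw [dif_pos h]
    exact (extendZero_apply Subtype.val_injective y ⟨i, h⟩).symm
  · rw [dif_neg h, extendZero_of_notMem]
    rintro ⟨a, rfl⟩
    exact h a.2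

theorem mainTheorem6 (n : ℕ) (hn : 6 ≤ n) (f : (Fin n → ZMod 3) → Block)
    (hdeg : functionInducedDegree f = 1) (h0 : f 0 = Block.X) :
    ∃ I : Finset (Fin n), n - 4 ≤ I.card ∧ IsCanonicalFunction (restrictToCoords f I) := by
  have hf : Good f := (functionInducedDegree_le_one_iff f).mp hdeg.le
  have : Nonempty (Fin n) := ⟨⟨0, by omega⟩⟩
  obtain ⟨I, hcard, hI⟩ := exists_indep_of_good hf h0
  obtain ⟨ε, hε, hD⟩ := exists_dom_sign hf h0 hI
  rw [Fintype.card_fin] at hcard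
  refine ⟨I, hcard, ?_⟩
  rw [restrictToCoords_eq]
  refine isCanonicalFunction_of_sum_notMem (hf.extendZero Subtype.val_injective)
    (by rw [Function.comp_apply, extendZero_zero, h0]) (ε := fun i => ε i) (fun i => hε i)
    fun y => ?_
  have hy : ∀ i, extendZero (Subtype.val : I → Fin n) y i ≠ 0 → i ∈ I := fun i hi => by
    by_contra h
    refine hi (extendZero_of_notMem y ?_)
    rintro ⟨a, rfl⟩
    exact h a.2
  have hsum : ∑ i : I, ε i * y i = ∑ i ∈ I, ε i * extendZero (Subtype.val : I → Fin n) y i := by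
    rw [← Finset.sum_coe_sort I fun i => ε i * extendZero (Subtype.val : I → Fin n) y i]
    exact Finset.sum_congr rfl fun i _ => by rw [extendZero_apply Subtype.val_injective y i]
  rw [hsum]
  exact sum_notMem hf h0 hε hI hD hy
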